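/- Let $F=F(x_1,\dots,x_r)$ be the free group of rank $r$, $A_r=F/F'$ the free abelian group and $M_r=F/F''$ the free metabelian group of rank $r$. For $u\in F$ let $\partial u/\partial x_i\in\mathbb{Z}F$ be its Fox derivatives (so $\partial x_j/\partial x_i=\delta_{ij}$ and $\partial(uv)/\partial x_i=\partial u/\partial x_i+u\,\partial v/\partial x_i$), and let $m_{\delta,i}\in\mathbb{Z}$ be the coefficient of $x_1^{\delta_1}\cdots x_r^{\delta_r}$ in the image of $\partial u/\partial x_i$ in $\mathbb{Z}A_r$. Consider the following algorithm. Input: $r$ and a word $w=x_{i_1}^{\varepsilon_1}\cdots x_{i_n}^{\varepsilon_n}$, $\varepsilon_j=\pm1$, of length $|w|=n$. It keeps a vector $\delta\in\mathbb{Z}^r$, initially $0$, and a binary trie, initially empty, whose keys are the binary codes of pairs $(\delta,i)$ with $|\delta_j|\le n$, $1\le i\le r$ ($\lceil\log_2(n+1)\rceil$ bits and a sign bit for each coordinate $\delta_j$, and $\lceil\log_2 r\rceil$ bits for $i$) and whose values are integers, the value of a new key being $0$. For $j=1,\dots,n$: if $\varepsilon_j=1$, it adds $1$ to the value at the key $(\delta,i_j)$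 and then adds $1$ to $\delta_{i_j}$; if $\varepsilon_j=-1$, it subtracts $1$ from $\delta_{i_j}$ and then subtracts $1$ from the value at the key $(\delta,i_j)$. Finally it scans the values in the trie and answers True if all of them are $0$, and False otherwise. The algorithm is carried out by a single program, independent of $r$ and $w$, on a random access machine with finitely many integer registers and arrays. Each of the following counts as one elementary step: setting a register to $0$, copying a register, changing a register by $\pm1$, reading or writing an array cell, testing two registers for equality. **Theorem.** For all $r$ and $w$ the algorithm halts. 1. When it has read $w$, the trie represents all Fox derivatives of $w$ in $\mathbb{Z}A_r$: every $(\delta,i)$ with $m_{\delta,i}\neq0$ satisfies $|\delta_j|\le|w|$ for all $j$, and the paths of the trie that start at the root and end in a nonzero value are exactly those labeled by the codes of the pairs $(\delta,i)$ with $m_{\delta,i}\ne 0$, the value being $m_{\delta,i}$. 2. The answer is True if $w=1$ in $M_r$, and False if $w\neq1$ in $M_r$. Moreover, $w=1$ in $M_r$ if and only if all Fox derivatives of $w$ vanish in $\mathbb{Z}A_r$. 3. The algorithm runs in time $O(r|w|\log_2|w|)$: there is a constant $C$, independent of $r$ and $w$, such that it makes at most $C\,r\,|w|\log_2|w|$ elementary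 steps whenever $|w|\ge2$. -/

import Mathlib

/-! ## Free metabelian groups and Fox derivatives -/

/-- The free metabelian group `M_r = F / F''` of rank `r`, where `F` is free on `r` generators
(`derivedSeries F 1 = [F, F]` and `derivedSeries F 2 = [[F, F], [F, F]]`). -/
abbrev FreeMetabelian (r : ℕ) : Type :=
  FreeGroup (Fin r) ⧸ derivedSeries (FreeGroup (Fin r)) 2

/-- The free abelian group `A_r = F / F'` of rank `r`, written multiplicatively. -/
abbrev FreeAb (r : ℕ) : Type := Abelianization (FreeGroup (Fin r))

/-- The integral group ring of the free group of rank `r`. -/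
abbrev FreeGroupRing (r : ℕ) : Type := MonoidAlgebra ℤ (FreeGroup (Fin r))

noncomputable section

/-- The action of `F` on the additive group of `ℤF` by left multiplication. -/
def leftAction (r : ℕ) : FreeGroup (Fin r) →* MulAut (Multiplicative (FreeGroupRing r)) :=
  (MulAutMultiplicative (FreeGroupRing r)).symm.toMonoidHom.comp
    ((DistribMulAction.toAddAut (FreeGroupRing r)ˣ (FreeGroupRing r)).comp
      ((Units.map (MonoidAlgebra.of ℤ (FreeGroup (Fin r)))).comp toUnits.toMonoidHom))

/-- The homomorphism `F → ℤF ⋊ F`, `x_j ↦ (δ_{ij}, x_j)`.  Its first component is the derivation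
`∂/∂x_i`, restricted to `F`. -/
def foxHom (r : ℕ) (i : Fin r) :
    FreeGroup (Fin r) →* Multiplicative (FreeGroupRing r) ⋊[leftAction r] FreeGroup (Fin r) :=
  FreeGroup.lift fun j => ⟨Multiplicative.ofAdd (if j = i then 1 else 0), FreeGroup.of j⟩

/-- The free partial (Fox) derivative `∂u/∂x_i ∈ ℤF` of an element `u` of `F`: the map with
`∂x_j/∂x_i = δ_{ij}` and `∂(uv)/∂x_i = ∂u/∂x_i + u ∂v/∂x_i` (see the lemmas below). -/
def foxDeriv {r : ℕ} (i : Fin r) (u : FreeGroup (Fin r)) : FreeGroupRing r :=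
  Multiplicative.toAdd (foxHom r i u).left

theorem foxDeriv_of {r : ℕ} (i j : Fin r) :
    foxDeriv i (FreeGroup.of j) = if j = i then 1 else 0 := by
  simp [foxDeriv, foxHom]

theorem foxHom_right {r : ℕ} (i : Fin r) (u : FreeGroup (Fin r)) : (foxHom r i u).right = u := by
  have h : (SemidirectProduct.rightHom.comp (foxHom r i)) = MonoidHom.id _ := by
    ext j
    simp [foxHom]
  exact DFunLike.congr_fun h u

theorem foxDeriv_mul {r : ℕ} (i : Fin r) (u v : FreeGroup (Fin r)) :
    foxDeriv i (u * v) = foxDeriv i u + MonoidAlgebra.of ℤ _ u * foxDeriv i v := by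
  unfold foxDeriv
  rw [map_mul, SemidirectProduct.mul_left, foxHom_right]
  rfl

/-- The derivative `∂^μ u/∂x_i ∈ ℤA_r` induced by the canonical epimorphism `μ : F → A_r`. -/
def foxDerivAb {r : ℕ} (i : Fin r) (u : FreeGroup (Fin r)) : MonoidAlgebra ℤ (FreeAb r) :=
  MonoidAlgebra.mapDomainRingHom ℤ
    (Abelianization.of : FreeGroup (Fin r) →* FreeAb r) (foxDeriv i u)

/-- The element `x_1 ^ δ_1 ⋯ x_r ^ δ_r` of `A_r`. -/
def abElem {r : ℕ} (δ : Fin r → ℤ) : FreeAb r :=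
  ∏ j, Abelianization.of (FreeGroup.of j) ^ δ j

/-- `foxCoeff u δ i` is the coefficient of `∂^μ u/∂x_i` at `x_1 ^ δ_1 ⋯ x_r ^ δ_r`. -/
def foxCoeff {r : ℕ} (u : FreeGroup (Fin r)) (δ : Fin r → ℤ) (i : Fin r) : ℤ :=
  (foxDerivAb i u).coeff (abElem δ)

end

/-! ## The machine model

A random access machine with finitely many registers and finitely many memory arrays, all holding
integers and initially `0` except for the input.  The arithmetic instructions only change an
integer by one, so no intermediate value exceeds the input values plus the number of executed
steps, and unit cost is the honest cost of an elementary step. -/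

/-- The registers used by the program. -/
inductive Reg
  | rank | len
  | zero | one
  | digits | idxBits | codeStart | keyEnd
  | t | i | e | pos | start | j | k
  | m | half | bit | c
  | node | child | count | d | v
  | answer
  deriving DecidableEq

/-- The memory arrays used by the program: the input word (`idx`, `eps`), the binary key
(`key`) and the trie (child pointers `left`, `right` and the values `val` of the nodes). -/
inductive Arr
  | idx | eps | key | left | right | val
  deriving DecidableEq

structure MState where
  reg : Reg → ℤ
  mem : Arr → ℤ → ℤ

def MState.setReg (s : MState) (x : Reg) (a : ℤ) : MState :=
  { s with reg := Function.update s.reg x a }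

def MState.setMem (s : MState) (A : Arr) (p a : ℤ) : MState :=
  { s with mem := Function.update s.mem A (Function.update (s.mem A) p a) }

/-- Elementary instructions. -/
inductive Instr
  /-- `x := 0` -/
  | clear (x : Reg)
  /-- `x := y` -/
  | copy (x y : Reg)
  /-- `x := x + 1` -/
  | succ (x : Reg)
  /-- `x := x - 1` -/
  | pred (x : Reg)
  /-- `x := A[y]` -/
  | load (x : Reg) (A : Arr) (y : Reg)
  /-- `A[x] := y` -/
  | store (A : Arr) (x y : Reg)

def Instr.exec : Instr → MState → MState
  | .clear x, s => s.setReg x 0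
  | .copy x y, s => s.setReg x (s.reg y)
  | .succ x, s => s.setReg x (s.reg x + 1)
  | .pred x, s => s.setReg x (s.reg x - 1)
  | .load x A y, s => s.setReg x (s.mem A (s.reg y))
  | .store A x y, s => s.setMem A (s.reg x) (s.reg y)

/-- Programs: instructions, sequencing, branching on the equality of two registers, and loops
running as long as two registers differ. -/
inductive Prog
  | instr (a : Instr)
  | seq (p q : Prog)
  | ifEq (x y : Reg) (p q : Prog)
  | whileNe (x y : Reg) (p : Prog)

namespace Prog

infixr:60 " ;; " => Prog.seq

def clear (x : Reg) : Prog := .instr (.clear x)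
def copy (x y : Reg) : Prog := .instr (.copy x y)
def succ (x : Reg) : Prog := .instr (.succ x)
def pred (x : Reg) : Prog := .instr (.pred x)
def load (x : Reg) (A : Arr) (y : Reg) : Prog := .instr (.load x A y)
def store (A : Arr) (x y : Reg) : Prog := .instr (.store A x y)

/-- `Exec p s s' T`: started in the state `s`, the program `p` halts in the state `s'` after
exactly `T` elementary steps.  Every instruction and every test costs one step. -/
inductive Exec : Prog → MState → MState → ℕ → Prop
  | instr (a : Instr) (s : MState) : Exec (.instr a) s (a.exec s) 1
  | seq {p q : Prog} {s s' s'' : MState} {T T' : ℕ} :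
      Exec p s s' T → Exec q s' s'' T' → Exec (.seq p q) s s'' (T + T')
  | ifTrue {x y : Reg} {p q : Prog} {s s' : MState} {T : ℕ} :
      s.reg x = s.reg y → Exec p s s' T → Exec (.ifEq x y p q) s s' (T + 1)
  | ifFalse {x y : Reg} {p q : Prog} {s s' : MState} {T : ℕ} :
      s.reg x ≠ s.reg y → Exec q s s' T → Exec (.ifEq x y p q) s s' (T + 1)
  | whileDone {x y : Reg} {p : Prog} {s : MState} :
      s.reg x = s.reg y → Exec (.whileNe x y p) s s 1
  | whileStep {x y : Reg} {p : Prog} {s s' s'' : MState} {T T' : ℕ} :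
      s.reg x ≠ s.reg y → Exec p s s' T → Exec (.whileNe x y p) s' s'' T' →
      Exec (.whileNe x y p) s s'' (T + T' + 1)

/-- The machine is deterministic: the final state and the number of steps are unique. -/
theorem Exec.unique {p : Prog} {s s₁ s₂ : MState} {T₁ T₂ : ℕ}
    (h₁ : Exec p s s₁ T₁) (h₂ : Exec p s s₂ T₂) : s₁ = s₂ ∧ T₁ = T₂ := by
  induction h₁ generalizing s₂ T₂ with
  | instr a s => cases h₂; exact ⟨rfl, rfl⟩
  | seq _ _ ih ih' =>
    cases h₂ with
    | seq a b =>
      obtain ⟨rfl, rfl⟩ := ih a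
      obtain ⟨rfl, rfl⟩ := ih' b
      exact ⟨rfl, rfl⟩
  | ifTrue h _ ih =>
    cases h₂ with
    | ifTrue _ a => obtain ⟨rfl, rfl⟩ := ih a; exact ⟨rfl, rfl⟩
    | ifFalse h' _ => exact absurd h h'
  | ifFalse h _ ih =>
    cases h₂ with
    | ifTrue h' _ => exact absurd h' h
    | ifFalse _ a => obtain ⟨rfl, rfl⟩ := ih a; exact ⟨rfl, rfl⟩
  | whileDone h =>
    cases h₂ with
    | whileDone _ => exact ⟨rfl, rfl⟩
    | whileStep h' _ _ => exact absurd h h'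
  | whileStep h _ _ ih ih' =>
    cases h₂ with
    | whileDone h' => exact absurd h' h
    | whileStep _ a b =>
      obtain ⟨rfl, rfl⟩ := ih a
      obtain ⟨rfl, rfl⟩ := ih' b
      exact ⟨rfl, rfl⟩

/-! ## The algorithm -/

/-- `half := ⌊m / 2⌋`, `bit := m mod 2` (for `m ≥ 0`). -/
def halve : Prog :=
  clear .half ;; clear .bit ;; copy .c .m ;;
  whileNe .c .zero
    (pred .c ;; ifEq .c .zero (copy .bit .one) (pred .c ;; succ .half))

/-- `x :=` the number of binary digits of `m` (for `m ≥ 0`). -/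
def bitLength (x : Reg) : Prog :=
  clear x ;; whileNe .m .zero (halve ;; copy .m .half ;; succ x)

/-- Computes `digits = ⌈log₂ (len + 1)⌉`, and `idxBits = ⌈log₂ rank⌉`, and initializes the first
part of `key` with the code of the exponent vector `δ = (0, …, 0)`.  A coordinate `δ_j` takes a
block of `digits + 1` bits, the last one being the sign bit (`1` for `δ_j ≥ 0`); it holds
`δ_j + 2 ^ digits` in binary, least significant bit first. -/
def setup : Prog :=
  clear .zero ;; clear .one ;; succ .one ;;
  copy .m .len ;; bitLength .digits ;;
  copy .m .rank ;; ifEq .m .zero (clear .m) (pred .m) ;; bitLength .idxBits ;;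
  clear .pos ;; clear .j ;;
  whileNe .j .rank
    (clear .k ;;
     whileNe .k .digits (store .key .pos .zero ;; succ .pos ;; succ .k) ;;
     store .key .pos .one ;; succ .pos ;; succ .j) ;;
  copy .codeStart .pos ;; copy .keyEnd .pos ;; clear .k ;;
  whileNe .k .idxBits (succ .keyEnd ;; succ .k) ;;
  clear .count

/-- Writes the binary code of the index `i` behind the code of `δ`; now `key` holds `(δ, i)*`. -/
def writeIndex : Prog :=
  copy .m .i ;; copy .pos .codeStart ;;
  whileNe .pos .keyEnd (halve ;; store .key .pos .bit ;; copy .m .half ;; succ .pos)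

/-- `start :=` the first position in `key` of the block of the coordinate `δ_i`. -/
def locateBlock : Prog :=
  clear .start ;; clear .j ;;
  whileNe .j .i
    (clear .k ;; whileNe .k .digits (succ .start ;; succ .k) ;; succ .start ;; succ .j)

/-- Follows the path labeled by `key` from the root (node `0`), and creates the nodes missing on
it.  The pointer `0` means that there is no child.  A new node has the value `0`. -/
def walk : Prog :=
  clear .node ;; clear .pos ;;
  whileNe .pos .keyEnd
    (load .d .key .pos ;;
     ifEq .d .zero (load .child .left .node) (load .child .right .node) ;;
     ifEq .child .zero
       (succ .count ;; copy .child .count ;;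
        ifEq .d .zero (store .left .node .child) (store .right .node .child))
       (clear .c) ;;
     copy .node .child ;; succ .pos)

/-- Adds `1` to the coordinate `δ_i` (binary increment with carry). -/
def incCoord : Prog :=
  copy .pos .start ;; load .d .key .pos ;;
  whileNe .d .zero (store .key .pos .zero ;; succ .pos ;; load .d .key .pos) ;;
  store .key .pos .one

/-- Subtracts `1` from the coordinate `δ_i` (binary decrement with borrow). -/
def decCoord : Prog :=
  copy .pos .start ;; load .d .key .pos ;;
  whileNe .d .one (store .key .pos .one ;; succ .pos ;; load .d .key .pos) ;;
  store .key .pos .zero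

/-- Computes the Fox derivatives of the input word `x_{i_1} ^ ε_1 ⋯ x_{i_n} ^ ε_n` in `ℤA_r`,
stored in the trie, while reading the word letter by letter. -/
def foxProgram : Prog :=
  setup ;; clear .t ;;
  whileNe .t .len
    (load .i .idx .t ;; load .e .eps .t ;; writeIndex ;; locateBlock ;;
     ifEq .e .one
       (walk ;; load .v .val .node ;; succ .v ;; store .val .node .v ;; incCoord)
       (decCoord ;; walk ;; load .v .val .node ;; pred .v ;; store .val .node .v) ;;
     succ .t)

/-- Scans the nodes `1, …, count` of the trie; `answer = 1` (true) if all values are `0`, and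
`answer = 0` (false) otherwise. -/
def checkProgram : Prog :=
  copy .answer .one ;; clear .node ;;
  whileNe .node .count
    (succ .node ;; load .v .val .node ;; ifEq .v .zero (clear .c) (clear .answer))

/-- The algorithm for the word problem in the free metabelian groups. -/
def wordProblemProgram : Prog := foxProgram ;; checkProgram

end Prog

/-! ## Input and output -/

/-- The initial state for the rank `r` and the word `w`, a list of letters `x_i ^ ε`, the pair
`(i, true)` standing for `x_i` and `(i, false)` for `x_i⁻¹` (as in `FreeGroup.mk`). -/
def inputState (r : ℕ) (w : List (Fin r × Bool)) : MState where
  reg x := match x with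
    | .rank => r
    | .len => w.length
    | _ => 0
  mem A p := match A, (if 0 ≤ p then w[p.toNat]? else none) with
    | .idx, some (i, _) => (i : ℕ)
    | .eps, some (_, b) => if b then 1 else -1
    | _, _ => 0

/-- The node reached from the node `x` along a path of the trie with the given labels. -/
def MState.descend (s : MState) : ℤ → List Bool → Option ℤ
  | x, [] => some x
  | x, b :: bs =>
    if s.mem (if b then .right else .left) x = 0 then none
    else s.descend (s.mem (if b then .right else .left) x) bs

/-- The value at the end of the path from the root labeled by `bs`, if the path exists. -/
def MState.lookup (s : MState) (bs : List Bool) : Option ℤ :=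
  (s.descend 0 bs).map (s.mem .val)

/-- The `k` lowest binary digits of `a`, least significant first. -/
def bitList (k a : ℕ) : List Bool := (List.range k).map fun j => a.testBit j

/-- The binary word `(δ, i)*` for words of length `n`: each coordinate takes `⌈log₂ (n + 1)⌉` bits
and a sign bit, and the index takes `⌈log₂ r⌉` bits. -/
def pairCode {r : ℕ} (n : ℕ) (δ : Fin r → ℤ) (i : Fin r) : List Bool :=
  (List.ofFn δ).flatMap
      (fun a => bitList (Nat.clog 2 (n + 1) + 1) (a + 2 ^ Nat.clog 2 (n + 1)).toNat) ++
    bitList (Nat.clog 2 r) i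

/-- The trie in the memory represents the finite map `S_u`, `(δ, i) ↦ m_{δ,i}`, the restriction of
the coefficients of all derivatives `∂^μ u/∂x_i` to their support: the paths of the trie that end
in a nonzero value are exactly those labeled by the codes `(δ, i)*` with `m_{δ,i} ≠ 0`, and they
end in the value `m_{δ,i}`.  The first part says that the exponents in the support are in the range
in which the code is faithful. -/
def MState.RepresentsFox (s : MState) {r : ℕ} (n : ℕ) (u : FreeGroup (Fin r)) : Prop :=
  (∀ (δ : Fin r → ℤ) (i : Fin r), foxCoeff u δ i ≠ 0 → ∀ j, |δ j| ≤ (n : ℤ)) ∧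
  ∀ (bs : List Bool) (v : ℤ), v ≠ 0 →
    (s.lookup bs = some v ↔
      ∃ (δ : Fin r → ℤ) (i : Fin r), bs = pairCode n δ i ∧ foxCoeff u δ i = v)

/-! Correctness of the trie is local. If `u` is the prefix already read, the product rule gives `∂(u
x_i)/∂x_i = ∂u/∂x_i + u` and `∂(u x_i⁻¹)/∂x_i = ∂u/∂x_i - u x_i⁻¹`, while the other derivatives do
not change. So in `ℤA_r` each letter changes exactly one coefficient, by `±1`. It sits at the
exponent vector of the prefix before the letter if the letter is positive, and after it if the
letter is negative (`foxCoeff_mul_of`, `foxCoeff_mul_of_inv`). This is what the program does to the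
value at its current key. Exponent vectors of prefixes are bounded by `|w|`, where the binary code
is injective (`pairCode_injOn`), so distinct coefficients never share a key.

The word problem reduces to the fact that the common kernel of the derivatives over `ℤA_r` is `F''`
(`mem_derivedSeries_two_iff`). They vanish on `F''` because on `F'` they are homomorphisms into an
abelian group. Conversely, think of `u` as a path in the Cayley graph of `A_r`; its derivatives
count the signed passages through the edges. If they vanish, the fundamental formula `∑ ∂u/∂x_i (x_i
- 1) = u - 1` puts `u` in `F'`. A section of `F → A_r` turns every edge into an element of `F'`, and
modulo `F''` the closed path of `u` is the sum of its edges with these multiplicities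
(`closedPath_eq_sum`), hence trivial.

For the time bound let `D = ⌈log₂(n + 1)⌉`. A key has `r(D + 1) + ⌈log₂ r⌉` bits, and writing the
index, locating a block, changing a coordinate and walking in the trie all take `O(rD)` steps per
letter. At most one node is created per bit walked, so the final scan is `O(rnD)` too, and `D ≤ 2
log₂ n` for `n ≥ 2`.

The program is verified with the predicate `Prog.Halts`, which carries a step bound and a
postcondition, and a loop invariant (`LoopInv`) relating the memory to the prefix read. Between
machine and algebra stands a function `f` on binary words: `IsTrie` says that the memory stores `f`,
`IsFoxMap` that `f` encodes the Fox coefficients. -/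

/-! ## Exponent vectors and the free abelian group -/

/-- The exponent sum of the generator `x_j` in an element of the free group. -/
def expVec {r : ℕ} (u : FreeGroup (Fin r)) (j : Fin r) : ℤ :=
  Multiplicative.toAdd
    (FreeGroup.lift (fun k => Multiplicative.ofAdd (if k = j then (1 : ℤ) else 0)) u)

theorem expVec_one {r : ℕ} : expVec (1 : FreeGroup (Fin r)) = 0 := by
  ext j; simp [expVec]

theorem expVec_mul {r : ℕ} (u v : FreeGroup (Fin r)) :
    expVec (u * v) = expVec u + expVec v := by
  ext j; simp [expVec]

theorem expVec_inv {r : ℕ} (u : FreeGroup (Fin r)) : expVec u⁻¹ = -expVec u := by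
  ext j; simp [expVec]

theorem expVec_of {r : ℕ} (i : Fin r) : expVec (FreeGroup.of i) = Pi.single i 1 := by
  ext j; simp [expVec, Pi.single_apply, eq_comm]

theorem abElem_zero {r : ℕ} : abElem (0 : Fin r → ℤ) = 1 := by simp [abElem]

theorem abElem_add {r : ℕ} (δ ε : Fin r → ℤ) : abElem (δ + ε) = abElem δ * abElem ε := by
  simp [abElem, zpow_add, Finset.prod_mul_distrib]

theorem abElem_neg {r : ℕ} (δ : Fin r → ℤ) : abElem (-δ) = (abElem δ)⁻¹ := by
  simp [abElem]

theorem abElem_single {r : ℕ} (i : Fin r) :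
    abElem (Pi.single i 1) = Abelianization.of (FreeGroup.of i) := by
  unfold abElem
  rw [Finset.prod_eq_single i]
  · simp
  · intro j _ hj; simp [hj]
  · simp

theorem abElem_expVec {r : ℕ} (u : FreeGroup (Fin r)) :
    abElem (expVec u) = Abelianization.of u := by
  induction u using FreeGroup.induction_on with
  | C1 => rw [expVec_one, abElem_zero, map_one]
  | of i => rw [expVec_of, abElem_single]
  | inv_of i h => rw [expVec_inv, abElem_neg, h, map_inv]
  | mul u v hu hv => rw [expVec_mul, abElem_add, hu, hv, map_mul]

theorem abElem_injective {r : ℕ} : Function.Injective (abElem (r := r)) := by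
  intro δ ε h
  ext j
  -- The exponent sum of `x_j` factors through `A_r` and recovers the coordinate `δ j`.
  have key : ∀ δ : Fin r → ℤ, Multiplicative.toAdd (Abelianization.lift (FreeGroup.lift
      (fun k => Multiplicative.ofAdd (if k = j then (1 : ℤ) else 0))) (abElem δ)) = δ j := by
    intro δ
    simp [abElem, apply_ite]
  rw [← key δ, h, key ε]

theorem abElem_surjective {r : ℕ} : Function.Surjective (abElem (r := r)) := by
  intro a
  induction a using QuotientGroup.induction_on with
  | H u => exact ⟨expVec u, abElem_expVec u⟩

/-! ## Fox derivatives over the free abelian group -/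

theorem foxDerivAb_mul {r : ℕ} (i : Fin r) (u v : FreeGroup (Fin r)) :
    foxDerivAb i (u * v) =
      foxDerivAb i u + MonoidAlgebra.of ℤ _ (Abelianization.of u) * foxDerivAb i v := by
  simp only [foxDerivAb, foxDeriv_mul, map_add, map_mul]
  congr 2
  simp

theorem foxDerivAb_one {r : ℕ} (i : Fin r) : foxDerivAb i (1 : FreeGroup (Fin r)) = 0 := by
  have h := foxDerivAb_mul i (1 : FreeGroup (Fin r)) 1
  rw [mul_one, map_one, map_one, one_mul] at h
  simpa using h

theorem foxDerivAb_of {r : ℕ} (i j : Fin r) :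
    foxDerivAb i (FreeGroup.of j) = if j = i then 1 else 0 := by
  simp [foxDerivAb, foxDeriv_of, apply_ite]

theorem foxDerivAb_inv {r : ℕ} (i : Fin r) (u : FreeGroup (Fin r)) :
    foxDerivAb i u⁻¹ = -(MonoidAlgebra.of ℤ _ (Abelianization.of u)⁻¹ * foxDerivAb i u) := by
  have h := foxDerivAb_mul i u⁻¹ u
  rw [inv_mul_cancel, foxDerivAb_one, map_inv] at h
  exact eq_neg_of_add_eq_zero_left h.symm

theorem foxDerivAb_mul_of {r : ℕ} (i a : Fin r) (u : FreeGroup (Fin r)) :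
    foxDerivAb i (u * FreeGroup.of a) =
      foxDerivAb i u + if a = i then MonoidAlgebra.of ℤ _ (Abelianization.of u) else 0 := by
  rw [foxDerivAb_mul, foxDerivAb_of]
  split_ifs <;> simp

theorem foxCoeff_one {r : ℕ} (δ : Fin r → ℤ) (i : Fin r) :
    foxCoeff (1 : FreeGroup (Fin r)) δ i = 0 := by
  simp [foxCoeff, foxDerivAb_one]

theorem foxCoeff_mul_of {r : ℕ} (u : FreeGroup (Fin r)) (a i : Fin r) (δ : Fin r → ℤ) :
    foxCoeff (u * FreeGroup.of a) δ i =
      foxCoeff u δ i + if δ = expVec u ∧ i = a then 1 else 0 := by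
  classical
  have h : (Abelianization.of u = abElem δ) ↔ δ = expVec u := by
    rw [← abElem_expVec, abElem_injective.eq_iff, eq_comm]
  simp only [foxCoeff, foxDerivAb_mul_of, MonoidAlgebra.coeff_add, Finsupp.add_apply]
  congr 1
  by_cases hi : a = i
  · rw [if_pos hi, MonoidAlgebra.of_apply, MonoidAlgebra.coeff_single, Finsupp.single_apply]
    simp [h, hi]
  · simp [hi, Ne.symm hi]

/-- The positive case applied to `u x_a⁻¹` in place of `u`. The changed coefficient therefore sits
at the vector after the letter, which is why the program decrements `δ` before using the key. -/
theorem foxCoeff_mul_of_inv {r : ℕ} (u : FreeGroup (Fin r)) (a i : Fin r) (δ : Fin r → ℤ) :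
    foxCoeff (u * (FreeGroup.of a)⁻¹) δ i =
      foxCoeff u δ i - if δ = expVec (u * (FreeGroup.of a)⁻¹) ∧ i = a then 1 else 0 := by
  have h := foxCoeff_mul_of (u * (FreeGroup.of a)⁻¹) a i δ
  rw [inv_mul_cancel_right] at h
  linarith

theorem foxDerivAb_eq_zero_iff {r : ℕ} (u : FreeGroup (Fin r)) :
    (∀ i, foxDerivAb i u = 0) ↔ ∀ δ i, foxCoeff u δ i = 0 := by
  constructor
  · intro h δ i; simp [foxCoeff, h]
  · intro h i
    ext a
    obtain ⟨δ, rfl⟩ := abElem_surjective a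
    exact h δ i

/-! ## The kernel of the Fox derivatives -/

/-- The factor `u` in the product rule becomes `1` in `ℤA_r` when `u ∈ F'`, so the derivative
restricts to a homomorphism from `F'` to an abelian group and kills `[F', F']`. -/
theorem foxDerivAb_eq_zero_of_mem {r : ℕ} {u : FreeGroup (Fin r)}
    (hu : u ∈ derivedSeries (FreeGroup (Fin r)) 2) (i : Fin r) : foxDerivAb i u = 0 := by
  let N := commutator (FreeGroup (Fin r))
  let φ : N →* Multiplicative (MonoidAlgebra ℤ (FreeAb r)) :=
    { toFun := fun x => Multiplicative.ofAdd (foxDerivAb i x)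
      map_one' := by simp [foxDerivAb_one]
      map_mul' := by
        rintro ⟨x, hx⟩ ⟨y, hy⟩
        have h1 : Abelianization.of x = 1 := by
          rw [← MonoidHom.mem_ker, Abelianization.ker_of]; exact hx
        change Multiplicative.ofAdd (foxDerivAb i (x * y)) =
          Multiplicative.ofAdd (foxDerivAb i x + foxDerivAb i y)
        rw [foxDerivAb_mul, h1, map_one, one_mul] }
  have h2 : derivedSeries (FreeGroup (Fin r)) 2 = (commutator N).map N.subtype := by
    rw [Subgroup.map_subtype_commutator, derivedSeries_succ, derivedSeries_one]
  rw [h2] at hu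
  obtain ⟨x, hx, rfl⟩ := hu
  exact Abelianization.commutator_subset_ker φ hx

/-- A set-theoretic section of `F → F / F'`. -/
noncomputable def abSection {r : ℕ} (a : FreeAb r) : FreeGroup (Fin r) :=
  Function.surjInv (f := Abelianization.of) QuotientGroup.mk_surjective a

theorem of_abSection {r : ℕ} (a : FreeAb r) : Abelianization.of (abSection a) = a :=
  Function.surjInv_eq _ a

/-- The path labeled by `u` which starts at the vertex `a` of the Cayley graph of `F / F'`,
closed up to an element of `F'` by means of the section. -/
noncomputable def closedPath {r : ℕ} (a : FreeAb r) (u : FreeGroup (Fin r)) :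
    commutator (FreeGroup (Fin r)) :=
  ⟨abSection a * u * (abSection (a * Abelianization.of u))⁻¹, by
    rw [← Abelianization.ker_of, MonoidHom.mem_ker]
    simp [of_abSection]⟩

/-- The segment closing the first path cancels the one opening the second, which starts where the
first ends. -/
theorem closedPath_mul {r : ℕ} (a : FreeAb r) (u v : FreeGroup (Fin r)) :
    closedPath a (u * v) = closedPath a u * closedPath (a * Abelianization.of u) v := by
  ext
  simp [closedPath, mul_assoc]

theorem closedPath_one {r : ℕ} (a : FreeAb r) : closedPath a 1 = 1 := by
  ext
  simp [closedPath]

/-- The homomorphism from the group of `1`-chains `ℤA_r` in the direction `x_i` to the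
abelianization of `F'` which sends every edge to the corresponding closed path. -/
noncomputable def edgeHom {r : ℕ} (i : Fin r) :
    MonoidAlgebra ℤ (FreeAb r) →+ Additive (Abelianization (commutator (FreeGroup (Fin r)))) :=
  (Finsupp.liftAddHom fun a => (zmultiplesHom _)
    (Additive.ofMul (Abelianization.of (closedPath a (FreeGroup.of i))))).comp
    MonoidAlgebra.coeffAddEquiv.toAddMonoidHom

theorem edgeHom_of {r : ℕ} (i : Fin r) (a : FreeAb r) :
    edgeHom i (MonoidAlgebra.of ℤ _ a) =
      Additive.ofMul (Abelianization.of (closedPath a (FreeGroup.of i))) := by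
  change (Finsupp.liftAddHom _) (Finsupp.single a 1) = _
  simp

/-- Modulo `F''` a closed path depends only on how often each edge is traversed. The starting vertex
`a` is arbitrary because in a product the second factor starts at a translated vertex. -/
theorem closedPath_eq_sum {r : ℕ} (u : FreeGroup (Fin r)) (a : FreeAb r) :
    Additive.ofMul (Abelianization.of (closedPath a u)) =
      ∑ i, edgeHom i (MonoidAlgebra.of ℤ _ a * foxDerivAb i u) := by
  induction u using FreeGroup.induction_on generalizing a with
  | C1 => simp [closedPath_one, foxDerivAb_one]
  | of j =>
    rw [Finset.sum_eq_single j]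
    · rw [foxDerivAb_of, if_pos rfl, mul_one, edgeHom_of]
    · intro i _ hi
      rw [foxDerivAb_of, if_neg (Ne.symm hi), mul_zero, map_zero]
    · simp
  -- The edge `x_j⁻¹` from `a` is the edge `x_j` from `a x_j⁻¹` traversed backwards.
  | inv_of j h =>
    have h1 := h (a * (Abelianization.of (FreeGroup.of j))⁻¹)
    have h2 := closedPath_mul a (FreeGroup.of j)⁻¹ (FreeGroup.of j)
    rw [inv_mul_cancel, closedPath_one, map_inv] at h2
    have h3 : closedPath a (FreeGroup.of j)⁻¹ =
      (closedPath (a * (Abelianization.of (FreeGroup.of j))⁻¹) (FreeGroup.of j))⁻¹ :=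
      eq_inv_of_mul_eq_one_left h2.symm
    rw [h3, map_inv, ofMul_inv, h1, ← Finset.sum_neg_distrib]
    refine Finset.sum_congr rfl fun i _ => ?_
    rw [foxDerivAb_inv, mul_neg, map_neg, ← mul_assoc, ← map_mul]
  | mul u v hu hv =>
    rw [closedPath_mul, map_mul, ofMul_mul, hu, hv, ← Finset.sum_add_distrib]
    refine Finset.sum_congr rfl fun i _ => ?_
    rw [foxDerivAb_mul, mul_add, map_add, ← mul_assoc, ← map_mul]

/-- Fox's fundamental formula; it shows that vanishing derivatives force `u ∈ F'`. -/
theorem sum_foxDerivAb_mul {r : ℕ} (u : FreeGroup (Fin r)) :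
    ∑ i, foxDerivAb i u * (MonoidAlgebra.of ℤ _ (Abelianization.of (FreeGroup.of i)) - 1) =
      MonoidAlgebra.of ℤ _ (Abelianization.of u) - 1 := by
  induction u using FreeGroup.induction_on with
  | C1 => simp [foxDerivAb_one, MonoidAlgebra.one_def]
  | of j => simp [foxDerivAb_of]
  | inv_of j h =>
    simp only [foxDerivAb_inv, neg_mul, Finset.sum_neg_distrib, mul_assoc, ← Finset.mul_sum, h]
    rw [mul_sub, ← map_mul, map_inv Abelianization.of, inv_mul_cancel, map_one]
    ring
  | mul u v hu hv =>
    simp only [foxDerivAb_mul, add_mul, Finset.sum_add_distrib, mul_assoc, ← Finset.mul_sum, hu, hv]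
    rw [map_mul, map_mul]
    ring

theorem mem_derivedSeries_two_iff {r : ℕ} (u : FreeGroup (Fin r)) :
    u ∈ derivedSeries (FreeGroup (Fin r)) 2 ↔ ∀ i, foxDerivAb i u = 0 := by
  refine ⟨fun h i => foxDerivAb_eq_zero_of_mem h i, fun h => ?_⟩
  have hab : Abelianization.of u = 1 := by
    have h1 := sum_foxDerivAb_mul u
    simp only [h, zero_mul, Finset.sum_const_zero] at h1
    exact MonoidAlgebra.of_injective ((sub_eq_zero.1 h1.symm).trans (map_one _).symm)
  have h2 := closedPath_eq_sum u 1
  simp only [h, mul_zero, map_zero, Finset.sum_const_zero] at h2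
  have h3 : closedPath 1 u ∈ commutator (commutator (FreeGroup (Fin r))) := by
    rw [← Abelianization.ker_of (commutator _), MonoidHom.mem_ker]
    exact h2
  have h4 : (closedPath 1 u : FreeGroup (Fin r)) ∈ derivedSeries (FreeGroup (Fin r)) 2 := by
    rw [derivedSeries_succ, derivedSeries_one, ← Subgroup.map_subtype_commutator]
    exact ⟨_, h3, rfl⟩
  -- The section need not send `1` to `1`, so the closed path of `u` is only a conjugate of `u`;
  -- normality of `F''` removes the conjugation.
  have hn := derivedSeries_normal (FreeGroup (Fin r)) 2
  have h5 := hn.conj_mem _ h4 (abSection (1 : FreeAb r))⁻¹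
  simpa [closedPath, hab, mul_assoc] using h5

theorem freeMetabelian_eq_one_iff {r : ℕ} (u : FreeGroup (Fin r)) :
    ((u : FreeMetabelian r) = 1) ↔ ∀ i, foxDerivAb i u = 0 := by
  rw [QuotientGroup.eq_one_iff, mem_derivedSeries_two_iff]

/-! ## Reasoning about programs -/

section
variable (s : MState)

@[simp] theorem MState.setReg_reg (x y : Reg) (a : ℤ) :
    (s.setReg x a).reg y = if y = x then a else s.reg y := by
  simp [MState.setReg, Function.update_apply]

@[simp] theorem MState.setReg_mem (x : Reg) (a : ℤ) : (s.setReg x a).mem = s.mem := rfl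

@[simp] theorem MState.setMem_reg (A : Arr) (p a : ℤ) : (s.setMem A p a).reg = s.reg := rfl

@[simp] theorem MState.setMem_mem (A B : Arr) (p a : ℤ) :
    (s.setMem A p a).mem B = if B = A then Function.update (s.mem A) p a else s.mem B := by
  simp [MState.setMem, Function.update_apply]

end

namespace Prog

/-- Started in `s`, the program `p` halts after at most `B` steps in a state satisfying `Q`. -/
def Halts (p : Prog) (s : MState) (B : ℕ) (Q : MState → Prop) : Prop :=
  ∃ s' T, Exec p s s' T ∧ T ≤ B ∧ Q s'

/-- Does the program contain an instruction that changes the register `z`? -/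
def writesReg (z : Reg) : Prog → Bool
  | .instr (.clear x) => x = z
  | .instr (.copy x _) => x = z
  | .instr (.succ x) => x = z
  | .instr (.pred x) => x = z
  | .instr (.load x _ _) => x = z
  | .instr (.store _ _ _) => false
  | .seq p q => p.writesReg z || q.writesReg z
  | .ifEq _ _ p q => p.writesReg z || q.writesReg z
  | .whileNe _ _ p => p.writesReg z

/-- Does the program contain an instruction that changes the array `A`? -/
def writesMem (A : Arr) : Prog → Bool
  | .instr (.store B _ _) => B = A
  | .instr _ => false
  | .seq p q => p.writesMem A || q.writesMem A
  | .ifEq _ _ p q => p.writesMem A || q.writesMem A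
  | .whileNe _ _ p => p.writesMem A

/-- A frame rule with a syntactic side condition, which `rfl` decides for each concrete program. -/
theorem Exec.reg_eq {p : Prog} {s s' : MState} {T : ℕ} (h : Exec p s s' T) {z : Reg}
    (hz : p.writesReg z = false) : s'.reg z = s.reg z := by
  induction h with
  | instr a s =>
    cases a <;> simp_all [writesReg, Instr.exec, eq_comm]
  | seq _ _ ih ih' =>
    simp only [writesReg, Bool.or_eq_false_iff] at hz
    rw [ih' hz.2, ih hz.1]
  | ifTrue _ _ ih =>
    simp only [writesReg, Bool.or_eq_false_iff] at hz
    exact ih hz.1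
  | ifFalse _ _ ih =>
    simp only [writesReg, Bool.or_eq_false_iff] at hz
    exact ih hz.2
  | whileDone _ => rfl
  | whileStep _ _ _ ih ih' => rw [ih' hz, ih hz]

theorem Exec.mem_eq {p : Prog} {s s' : MState} {T : ℕ} (h : Exec p s s' T) {A : Arr}
    (hA : p.writesMem A = false) : s'.mem A = s.mem A := by
  induction h with
  | instr a s =>
    cases a <;> simp_all [writesMem, Instr.exec, eq_comm]
  | seq _ _ ih ih' =>
    simp only [writesMem, Bool.or_eq_false_iff] at hA
    rw [ih' hA.2, ih hA.1]
  | ifTrue _ _ ih =>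
    simp only [writesMem, Bool.or_eq_false_iff] at hA
    exact ih hA.1
  | ifFalse _ _ ih =>
    simp only [writesMem, Bool.or_eq_false_iff] at hA
    exact ih hA.2
  | whileDone _ => rfl
  | whileStep _ _ _ ih ih' => rw [ih' hA, ih hA]

variable {p q : Prog} {s : MState} {x y : Reg} {B B' b : ℕ} {P Q : MState → Prop}

theorem Halts.mono (h : Halts p s B P) (hB : B ≤ B') (hPQ : ∀ s', P s' → Q s') :
    Halts p s B' Q := by
  obtain ⟨s', T, h1, h2, h3⟩ := h
  exact ⟨s', T, h1, h2.trans hB, hPQ s' h3⟩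

theorem Halts.le (h : Halts p s B Q) (hB : B ≤ B') : Halts p s B' Q := h.mono hB fun _ h => h

/-- What the program does not write is preserved. -/
theorem Halts.frame (h : Halts p s B P) :
    Halts p s B fun s' => P s' ∧ (∀ z, p.writesReg z = false → s'.reg z = s.reg z) ∧
      ∀ A, p.writesMem A = false → s'.mem A = s.mem A := by
  obtain ⟨s', T, h1, h2, h3⟩ := h
  exact ⟨s', T, h1, h2, h3, fun _ hz => h1.reg_eq hz, fun _ hA => h1.mem_eq hA⟩

/-- Continuation form: the postcondition of `p` is that `q` halts suitably, so straight-line code is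
executed symbolically, one instruction at a time. -/
theorem Halts.seq (h : Halts p s B fun s' => Halts q s' B' Q) : Halts (p ;; q) s (B + B') Q := by
  obtain ⟨s', T, h1, h2, s'', T', h3, h4, h5⟩ := h
  exact ⟨s'', T + T', .seq h1 h3, by omega, h5⟩

theorem Halts.seq_of (h : Halts p s B P) (h' : ∀ s', P s' →
      (∀ z, p.writesReg z = false → s'.reg z = s.reg z) →
      (∀ A, p.writesMem A = false → s'.mem A = s.mem A) → Halts q s' B' Q) :
    Halts (p ;; q) s (B + B') Q :=
  .seq (h.frame.mono le_rfl fun s' hs' => h' s' hs'.1 hs'.2.1 hs'.2.2)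

theorem Halts.instr {a : Instr} (h : Q (a.exec s)) : Halts (.instr a) s 1 Q :=
  ⟨_, 1, .instr a s, le_rfl, h⟩

theorem Halts.instr_seq {a : Instr} (h : Halts q (a.exec s) B Q) :
    Halts (.instr a ;; q) s (B + 1) Q :=
  add_comm 1 B ▸ .seq (.instr h)

theorem Halts.ifEq (h : if s.reg x = s.reg y then Halts p s B Q else Halts q s B Q) :
    Halts (.ifEq x y p q) s (B + 1) Q := by
  split_ifs at h with hxy
  · obtain ⟨s', T, h1, h2, h3⟩ := h
    exact ⟨s', T + 1, .ifTrue hxy h1, by omega, h3⟩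
  · obtain ⟨s', T, h1, h2, h3⟩ := h
    exact ⟨s', T + 1, .ifFalse hxy h1, by omega, h3⟩

theorem Halts.whileNe_done (h : s.reg x = s.reg y) (hQ : Q s) : Halts (.whileNe x y p) s 1 Q :=
  ⟨s, 1, .whileDone h, le_rfl, hQ⟩

theorem Halts.whileNe_step (h : s.reg x ≠ s.reg y)
    (h' : Halts p s b fun s' => Halts (.whileNe x y p) s' B Q) :
    Halts (.whileNe x y p) s (b + B + 1) Q := by
  obtain ⟨s', T, h1, h2, s'', T', h3, h4, h5⟩ := h'
  exact ⟨s'', T + T' + 1, .whileStep h h1 h3, by omega, h5⟩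

/-- Unrolls one iteration while keeping the continuation `q`. The induction on carries and borrows
needs this, since there the loop and the final store form one statement. -/
theorem Halts.seq_whileNe_step (h : s.reg x ≠ s.reg y)
    (h' : Halts p s b fun s' => Halts (.whileNe x y p ;; q) s' B Q) :
    Halts (.whileNe x y p ;; q) s (b + B + 1) Q := by
  obtain ⟨s', T, h1, h2, s'', T', h3, h4, h5⟩ := h'
  cases h3 with
  | seq h6 h7 => exact ⟨s'', _, .seq (.whileStep h h1 h6) h7, by omega, h5⟩

/-- The rule for loops: `I n s` is the invariant, and `n` is a bound for the cost of the
remaining iterations. -/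
theorem Halts.whileNe (I : ℕ → MState → Prop) {n : ℕ} (h : I n s)
    (hdone : ∀ n s, I n s → s.reg x = s.reg y → Q s)
    (hstep : ∀ n s, I n s → s.reg x ≠ s.reg y →
      ∃ b n', b + n' + 1 ≤ n ∧ Halts p s b (I n')) :
    Halts (.whileNe x y p) s (n + 1) Q := by
  induction n using Nat.strong_induction_on generalizing s with
  | _ n ih =>
    by_cases hxy : s.reg x = s.reg y
    · exact (Halts.whileNe_done hxy (hdone n s h hxy)).mono (by omega) fun _ h => h
    · obtain ⟨b, n', h1, h2⟩ := hstep n s h hxy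
      refine (Halts.whileNe_step hxy (h2.mono le_rfl fun s' hs' => ih n' (by omega) hs')).mono
        (by omega) fun _ h => h

/-- The rule for loops with `d` iterations, each of which takes at most `b` steps. -/
theorem Halts.whileNe_count (d b : ℕ) (I : ℕ → MState → Prop) (h : I 0 s)
    (htest : ∀ c s, c ≤ d → I c s → (s.reg x = s.reg y ↔ c = d))
    (hstep : ∀ c s, c < d → I c s → Halts p s b (I (c + 1))) :
    Halts (.whileNe x y p) s (d * (b + 1) + 1) (I d) := by
  -- `c` iterations are done and `j` remain, each costing its body and one test.
  refine .whileNe (fun n s => ∃ c j, c + j = d ∧ I c s ∧ n = j * (b + 1))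
    ⟨0, d, by simp, h, rfl⟩ ?_ ?_
  · rintro n s ⟨c, j, hcj, hI, -⟩ hxy
    rwa [← (htest c s (by omega) hI).1 hxy]
  · rintro n s ⟨c, j, hcj, hI, hn⟩ hxy
    have : c ≠ d := fun h => hxy ((htest c s (by omega) hI).2 h)
    obtain _ | j := j
    · omega
    refine ⟨b, j * (b + 1), by rw [hn, Nat.succ_mul]; omega,
      (hstep c s (by omega) hI).mono le_rfl fun s' h => ⟨c + 1, j, by omega, h, rfl⟩⟩

end Prog

/-! ## Binary words in memory -/

theorem bitList_zero (a : ℕ) : bitList 0 a = [] := rfl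

theorem bitList_succ (k a : ℕ) : bitList (k + 1) a = decide (a % 2 = 1) :: bitList k (a / 2) := by
  simp only [bitList, List.range_succ_eq_map, List.map_cons, List.map_map, Nat.testBit_zero]
  congr 1
  refine List.map_congr_left fun j _ => ?_
  simp [Nat.testBit_succ]

@[simp] theorem length_bitList (k a : ℕ) : (bitList k a).length = k := by simp [bitList]

/-- The block of a coordinate `0`: the shift by `2 ^ k` leaves only the sign bit set. -/
theorem bitList_two_pow (k : ℕ) : bitList (k + 1) (2 ^ k) = List.replicate k false ++ [true] := by
  induction k with
  | zero => rfl
  | succ k ih =>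
    rw [bitList_succ, pow_succ, Nat.mul_div_cancel _ two_pos, ih, List.replicate_succ]
    simp

theorem bitList_injOn {k a b : ℕ} (ha : a < 2 ^ k) (hb : b < 2 ^ k)
    (h : bitList k a = bitList k b) : a = b := by
  induction k generalizing a b with
  | zero => simp at ha hb; omega
  | succ k ih =>
    rw [bitList_succ, bitList_succ, List.cons.injEq, decide_eq_decide] at h
    rw [pow_succ] at ha hb
    have := ih (by omega) (by omega) h.2
    omega

/-- The memory `m` holds the binary word `bs` from the position `p` on. -/
def Holds (m : ℤ → ℤ) : ℤ → List Bool → Prop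
  | _, [] => True
  | p, b :: bs => m p = (if b then 1 else 0) ∧ Holds m (p + 1) bs

theorem holds_append {m : ℤ → ℤ} {p : ℤ} {bs cs : List Bool} :
    Holds m p (bs ++ cs) ↔ Holds m p bs ∧ Holds m (p + bs.length) cs := by
  induction bs generalizing p with
  | nil => simp [Holds]
  | cons b bs ih =>
    simp only [List.cons_append, Holds, ih, and_assoc, List.length_cons]
    rw [show p + 1 + (bs.length : ℤ) = p + ((bs.length + 1 : ℕ) : ℤ) by push_cast; ring]

theorem Holds.congr {m m' : ℤ → ℤ} {p : ℤ} {bs : List Bool} (h : Holds m p bs)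
    (hm : ∀ q, p ≤ q → q < p + bs.length → m' q = m q) : Holds m' p bs := by
  induction bs generalizing p with
  | nil => trivial
  | cons b bs ih =>
    simp only [List.length_cons, Nat.cast_add, Nat.cast_one] at hm
    refine ⟨by rw [hm p le_rfl (by omega)]; exact h.1, ih h.2 fun q h1 h2 => ?_⟩
    exact hm q (by omega) (by omega)

theorem Holds.snoc {m : ℤ → ℤ} {bs : List Bool} {p a : ℤ} {b : Bool} (h : Holds m 0 bs)
    (hp : p = bs.length) (ha : a = if b then 1 else 0) :
    Holds (Function.update m p a) 0 (bs ++ [b]) := by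
  rw [holds_append]
  refine ⟨h.congr fun q _ h2 => Function.update_of_ne (by omega) _ _, ?_, trivial⟩
  rw [hp, zero_add, Function.update_self, ha]

/-! ## The subroutines on binary words -/

namespace Prog

variable {s : MState}

/-- The machine only changes integers by one, so halving counts down and is linear in `m`. -/
theorem halve_halts (m : ℕ) (hm : s.reg .m = m) (h0 : s.reg .zero = 0) (h1 : s.reg .one = 1) :
    Halts halve s (4 * m + 4) fun s' =>
      s'.reg .half = (m / 2 : ℕ) ∧ s'.reg .bit = (m % 2 : ℕ) := by
  refine Halts.mono (B := 4 * m + 1 + 1 + 1 + 1) ?_ (by omega) fun _ h => h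
  refine .instr_seq (.instr_seq (.instr_seq ?_))
  -- The weight `4` per unit of `c` is what a last odd iteration needs: three steps for the body and
  -- one for the test.
  refine .whileNe (fun n s => s.reg .zero = 0 ∧ s.reg .one = 1 ∧ ∃ c h b : ℕ, s.reg .c = c ∧
    s.reg .half = h ∧ s.reg .bit = b ∧ m = 2 * h + c + b ∧ (b = 0 ∨ b = 1 ∧ c = 0) ∧ n = 4 * c)
    ?_ ?_ ?_
  · refine ⟨by simpa [Instr.exec], by simpa [Instr.exec], m, 0, 0, ?_⟩
    simp [Instr.exec, hm]
  · rintro n s ⟨h0, h1, c, h, b, hc, hh, hb, hm, hcb, hn⟩ hx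
    rw [hh, hb]
    omega
  · rintro n s ⟨h0, h1, c, h, b, hc, hh, hb, hm, hcb, hn⟩ hx
    obtain _ | _ | c := c
    · simp [hc, h0] at hx
    · refine ⟨1 + 1 + 1, 0, by omega, .instr_seq (.ifEq ?_)⟩
      rw [if_pos (by simp [Instr.exec, hc, h0])]
      refine .instr ⟨by simpa [Instr.exec], by simpa [Instr.exec], 0, h, 1, ?_⟩
      simp [Instr.exec, hc, hh, h1]
      omega
    · refine ⟨1 + 1 + 1 + 1, 4 * c, by omega, .instr_seq (.ifEq ?_)⟩
      rw [if_neg (by simp [Instr.exec, hc, h0]; omega)]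
      refine .instr_seq (.instr ⟨by simpa [Instr.exec], by simpa [Instr.exec], c, h + 1, b, ?_⟩)
      simp [Instr.exec, hc, hh, hb]
      omega

theorem bitLength_halts {x : Reg} (hx : halve.writesReg x = false)
    (hxm : x ≠ .m ∧ x ≠ .zero ∧ x ≠ .one) (m : ℕ)
    (hm : s.reg .m = m) (h0 : s.reg .zero = 0) (h1 : s.reg .one = 1) :
    Halts (bitLength x) s (15 * m + 2) fun s' => s'.reg x = Nat.clog 2 (m + 1) := by
  obtain ⟨hx1, hx2, hx3⟩ := hxm
  -- An iteration at the value `a` costs `4 * a + 7` with its test, and `a` is halved each time, so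
  -- the total is a geometric series; the weight `15` is tight at `a = 2`.
  refine .instr_seq (.whileNe (fun n s => s.reg .zero = 0 ∧ s.reg .one = 1 ∧ ∃ a d : ℕ,
    s.reg .m = a ∧ s.reg x = d ∧ Nat.clog 2 (m + 1) = d + Nat.clog 2 (a + 1) ∧ n = 15 * a)
    ?_ ?_ ?_)
  · refine ⟨?_, ?_, m, 0, ?_, ?_, ?_, rfl⟩ <;>
      simp [Instr.exec, hm, h0, h1, hx1.symm, hx2.symm, hx3.symm]
  · rintro n s ⟨h0, h1, a, d, ha, hd, hl, hn⟩ hm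
    have : a = 0 := by omega
    subst this
    rw [hd, hl]
    simp
  · rintro n s ⟨h0, h1, a, d, ha, hd, hl, hn⟩ hm
    have ha0 : 1 ≤ a := by omega
    refine ⟨4 * a + 4 + (1 + 1), 15 * (a / 2), by omega, (halve_halts a ha h0 h1).seq_of ?_⟩
    rintro s' ⟨h, -⟩ hr -
    refine .instr_seq (.instr ⟨?_, ?_, a / 2, d + 1, ?_, ?_, ?_, rfl⟩)
    · simp [Instr.exec, hx2.symm, hr .zero rfl, h0]
    · simp [Instr.exec, hx3.symm, hr .one rfl, h1]
    · simp [Instr.exec, hx1.symm, h]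
    · simp [Instr.exec, hx1, hr x hx, hd]
    · rw [hl, Nat.clog_of_one_lt (n := a + 1) (by norm_num) (by omega),
        show (a + 1 + 2 - 1) / 2 = a / 2 + 1 by omega]
      ring

theorem writeIndex_halts (l : List Bool) (i k : ℕ) (hi : s.reg .i = i)
    (hs : s.reg .codeStart = l.length) (he : s.reg .keyEnd = (l.length + k : ℕ))
    (h0 : s.reg .zero = 0) (h1 : s.reg .one = 1) (hl : Holds (s.mem .key) 0 l) :
    Halts writeIndex s (8 * i + 8 * k + 3) fun s' =>
      Holds (s'.mem .key) 0 (l ++ bitList k i) := by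
  -- The part `l'` is written and `d` digits of `a` remain. Halving `a` frees at least `4 * a` of
  -- the budget, which pays for the halving itself.
  refine .instr_seq (.instr_seq (.whileNe (fun n s => s.reg .zero = 0 ∧ s.reg .one = 1 ∧
    ∃ (l' : List Bool) (a d : ℕ), s.reg .m = a ∧ s.reg .pos = l'.length ∧
      s.reg .keyEnd = (l'.length + d : ℕ) ∧ Holds (s.mem .key) 0 l' ∧
      l ++ bitList k i = l' ++ bitList d a ∧ n = 8 * a + 8 * d) ?_ ?_ ?_))
  · refine ⟨?_, ?_, l, i, k, ?_⟩ <;> simp [Instr.exec, *]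
  · rintro n s ⟨h0, h1, l', a, d, ha, hp, he, hl', hll, hn⟩ hx
    have : d = 0 := by omega
    subst this
    rw [hll, bitList_zero, List.append_nil]
    exact hl'
  · rintro n s ⟨h0, h1, l', a, d, ha, hp, he, hl', hll, hn⟩ hx
    obtain _ | d := d
    · omega
    refine ⟨4 * a + 4 + (1 + 1 + 1), 8 * (a / 2) + 8 * d, by omega,
      (halve_halts a ha h0 h1).seq_of ?_⟩
    rintro s' ⟨hh, hb⟩ hr hm
    refine .instr_seq (.instr_seq (.instr ⟨?_, ?_, l' ++ [decide (a % 2 = 1)], a / 2, d,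
      ?_, ?_, ?_, ?_, ?_, rfl⟩))
    · simp [Instr.exec, hr .zero rfl, h0]
    · simp [Instr.exec, hr .one rfl, h1]
    · simp [Instr.exec, hh]
    · simp [Instr.exec, hr .pos rfl, hp]
    · simp [Instr.exec, hr .keyEnd rfl, he]
      ring
    · simp only [Instr.exec, MState.setReg_mem, MState.setMem_mem, if_true]
      rw [hm .key rfl]
      refine hl'.snoc (by rw [hr .pos rfl, hp]) ?_
      rw [hb]
      rcases Nat.mod_two_eq_zero_or_one a with h | h <;> simp [h]
    · rw [hll, bitList_succ, List.append_assoc]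
      rfl

end Prog

/-! ### Initializing the key and locating coordinate blocks -/

namespace Prog

variable {s : MState}

theorem writeBlocks_halts (r D : ℕ) (hr : s.reg .rank = r) (hD : s.reg .digits = D)
    (h0 : s.reg .zero = 0) (h1 : s.reg .one = 1) (hj : s.reg .j = 0) (hp : s.reg .pos = 0) :
    Halts (.whileNe .j .rank
      (clear .k ;;
       .whileNe .k .digits (store .key .pos .zero ;; succ .pos ;; succ .k) ;;
       store .key .pos .one ;; succ .pos ;; succ .j)) s (r * (4 * D + 6) + 1) fun s' =>
      s'.reg .pos = (r * (D + 1) : ℕ) ∧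
      Holds (s'.mem .key) 0 (List.replicate r (bitList (D + 1) (2 ^ D))).flatten := by
  refine Halts.mono (Halts.whileNe_count r (4 * D + 5) (fun j s => s.reg .rank = r ∧
    s.reg .digits = D ∧ s.reg .zero = 0 ∧ s.reg .one = 1 ∧ s.reg .j = j ∧
    s.reg .pos = (j * (D + 1) : ℕ) ∧
    Holds (s.mem .key) 0 (List.replicate j (bitList (D + 1) (2 ^ D))).flatten) ?_ ?_ ?_)
    le_rfl fun s h => h.2.2.2.2.2
  · simp [*, Holds]
  · rintro c s - ⟨hr, -, -, -, hj, -⟩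
    rw [hr, hj]
    omega
  · rintro c s hc ⟨hr, hD, h0, h1, hj, hp, hl⟩
    refine Halts.le (.instr_seq (B := D * (3 + 1) + 1 + 3) ?_) (by omega)
    refine (Halts.seq_of (Halts.whileNe_count D 3 (fun k s => s.reg .digits = D ∧
      s.reg .zero = 0 ∧ s.reg .k = k ∧ s.reg .pos = (c * (D + 1) + k : ℕ) ∧
      Holds (s.mem .key) 0 ((List.replicate c (bitList (D + 1) (2 ^ D))).flatten ++
        List.replicate k false)) ?_ ?_ ?_) ?_)
    · simp [Instr.exec, *]
    · rintro k s - ⟨hD, -, hk, -⟩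
      rw [hD, hk]
      omega
    · rintro k s - ⟨hD, h0, hk, hp, hl⟩
      refine .instr_seq (.instr_seq (.instr ⟨?_, ?_, ?_, ?_, ?_⟩))
      · simpa [Instr.exec]
      · simpa [Instr.exec]
      · simp [Instr.exec, hk]
      · simp [Instr.exec, hp]
        ring
      · rw [List.replicate_succ', ← List.append_assoc]
        simp only [Instr.exec, MState.setReg_mem, MState.setMem_mem, if_true]
        exact hl.snoc (by simp [hp]) (by simp [h0])
    · rintro s' ⟨hD', h0', hk', hp', hl'⟩ hr' -
      refine .instr_seq (.instr_seq (.instr ?_))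
      refine ⟨?_, ?_, ?_, ?_, ?_, ?_, ?_⟩
      · simp [Instr.exec, hr' .rank rfl, hr]
      · simp [Instr.exec, hD']
      · simp [Instr.exec, h0']
      · simp [Instr.exec, hr' .one rfl, h1]
      · simp [Instr.exec, hr' .j rfl, hj]
      · simp [Instr.exec, hp']
        ring
      · simp only [Instr.exec, MState.setReg_mem, MState.setMem_mem, if_true]
        rw [List.replicate_succ', List.flatten_append, List.flatten_singleton,
          bitList_two_pow, ← List.append_assoc, ← bitList_two_pow]
        exact hl'.snoc (by simp [hp']) (by simp [hr' .one rfl, Instr.exec, h1])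

theorem setup_halts (r n : ℕ) (hr : s.reg .rank = r) (hn : s.reg .len = n) :
    Halts setup s (15 * n + 15 * r + r * (4 * Nat.clog 2 (n + 1) + 6) + 3 * Nat.clog 2 r + 20)
      fun s' => s'.reg .zero = 0 ∧ s'.reg .one = 1 ∧ s'.reg .digits = Nat.clog 2 (n + 1) ∧
        s'.reg .codeStart = (r * (Nat.clog 2 (n + 1) + 1) : ℕ) ∧
        s'.reg .keyEnd = (r * (Nat.clog 2 (n + 1) + 1) + Nat.clog 2 r : ℕ) ∧
        s'.reg .count = 0 ∧ Holds (s'.mem .key) 0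
          (List.replicate r (bitList (Nat.clog 2 (n + 1) + 1) (2 ^ Nat.clog 2 (n + 1)))).flatten := by
  let D := Nat.clog 2 (n + 1)
  let K := Nat.clog 2 r
  refine Halts.le (.instr_seq (.instr_seq (.instr_seq (.instr_seq (B := 15 * n + 2 + (2 +
    (15 * (r - 1) + 2 + (r * (4 * D + 6) + 1 + (K * (2 + 1) + 1 + 1 + 1 + 1 + 1) + 1 + 1)) + 1)) ?_))))
    (by dsimp only [D, K]; omega)
  refine (bitLength_halts (x := .digits) rfl (by decide) n ?_ ?_ ?_).seq_of fun s₁ hd hr₁ _ => ?_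
  · simp [Instr.exec, hn]
  · simp [Instr.exec]
  · simp [Instr.exec]
  have h0 := hr₁ .zero rfl
  have h1 := hr₁ .one rfl
  have hr' := hr₁ .rank rfl
  simp [Instr.exec, hr] at h0 h1 hr'
  refine .instr_seq (.seq_of (P := fun s' => s'.reg .m = (r - 1 : ℕ)) (B := 2)
    (.ifEq ?_) fun s₂ hm hr₂ _ => ?_)
  · split_ifs with h
    · refine .instr ?_
      simp [Instr.exec, h0, hr'] at h ⊢
      omega
    · refine .instr ?_
      simp [Instr.exec, h0, hr'] at h ⊢
      omega
  have h0₂ := hr₂ .zero rfl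
  have h1₂ := hr₂ .one rfl
  have hd₂ := hr₂ .digits rfl
  have hrk₂ := hr₂ .rank rfl
  simp [Instr.exec, h0, h1, hd, hr'] at h0₂ h1₂ hd₂ hrk₂
  refine (bitLength_halts (x := .idxBits) rfl (by decide) (r - 1) hm h0₂ h1₂).seq_of fun s₃ hi hr₃ _ => ?_
  rw [← hr₃ .zero rfl] at h0₂
  rw [← hr₃ .one rfl] at h1₂
  rw [← hr₃ .digits rfl] at hd₂
  rw [← hr₃ .rank rfl] at hrk₂
  -- `bitLength` computes `⌈log₂(m + 1)⌉`, hence the input `r - 1`. For `r = 0` the truncated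
  -- subtraction is harmless: `clog` is `0` at both `0` and `1`.
  have hK : Nat.clog 2 (r - 1 + 1) = Nat.clog 2 r := by
    obtain _ | r := r <;> simp
  rw [hK] at hi
  clear hr₁ hr₂ hr₃
  refine .instr_seq (.instr_seq (.seq_of (writeBlocks_halts r (Nat.clog 2 (n + 1)) ?_ ?_ ?_ ?_ ?_ ?_)
    fun s₄ h₄ hr₄ _ => ?_))
  iterate 6 simp [Instr.exec, *]
  have h0₄ := hr₄ .zero rfl
  have h1₄ := hr₄ .one rfl
  have hd₄ := hr₄ .digits rfl
  have hi₄ := hr₄ .idxBits rfl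
  simp [Instr.exec, h0₂, h1₂, hd₂, hi] at h0₄ h1₄ hd₄ hi₄
  obtain ⟨hp₄, hl₄⟩ := h₄
  refine .instr_seq (.instr_seq (.instr_seq (.seq_of (B' := 1) (Halts.whileNe_count (Nat.clog 2 r) 2
    (fun k s => s.reg .k = k ∧ s.reg .idxBits = Nat.clog 2 r ∧
      s.reg .keyEnd = (r * (Nat.clog 2 (n + 1) + 1) + k : ℕ)) ?_ ?_ ?_) fun s₅ h₅ hr₅ hm₅ => ?_)))
  · simp [Instr.exec, hp₄, hi₄]
  · rintro c s - ⟨hk, hi, -⟩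
    rw [hk, hi]
    omega
  · rintro c s - ⟨hk, hi, he⟩
    refine .instr_seq (.instr ?_)
    simp [Instr.exec, hk, hi, he]
    ring
  · refine .instr ?_
    have h0₅ := hr₅ .zero rfl
    have h1₅ := hr₅ .one rfl
    have hd₅ := hr₅ .digits rfl
    have hc₅ := hr₅ .codeStart rfl
    simp [Instr.exec, h0₄, h1₄, hd₄, hp₄] at h0₅ h1₅ hd₅ hc₅
    simp [Instr.exec, h0₅, h1₅, hd₅, hc₅, h₅.2.2]
    rw [hm₅ .key rfl]
    exact hl₄

/-- The product `i * (D + 1)` is obtained by counting, which still fits the `O(rD)` budget of a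
letter. -/
theorem locateBlock_halts (i D : ℕ) (hi : s.reg .i = i) (hD : s.reg .digits = D) :
    Halts locateBlock s (i * (3 * D + 5) + 3) fun s' => s'.reg .start = (i * (D + 1) : ℕ) := by
  refine .instr_seq (.instr_seq (Halts.mono (Halts.whileNe_count i (3 * D + 4)
    (fun j s => s.reg .i = i ∧ s.reg .digits = D ∧ s.reg .j = j ∧
      s.reg .start = (j * (D + 1) : ℕ)) ?_ ?_ ?_) le_rfl fun s h => h.2.2.2))
  · simp [Instr.exec, hi, hD]
  · rintro c s - ⟨hi, -, hj, -⟩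
    rw [hi, hj]
    omega
  · rintro c s - ⟨hi, hD, hj, hs⟩
    refine Halts.le (.instr_seq (B := D * (2 + 1) + 1 + 2) ?_) (by omega)
    refine (Halts.whileNe_count D 2 (fun k s => s.reg .digits = D ∧ s.reg .k = k ∧
      s.reg .start = (c * (D + 1) + k : ℕ)) ?_ ?_ ?_).seq_of fun s' h hr _ => ?_
    · simp [Instr.exec, hD, hs]
    · rintro k s - ⟨hD, hk, -⟩
      rw [hD, hk]
      omega
    · rintro k s - ⟨hD, hk, hs⟩
      refine .instr_seq (.instr ?_)
      simp [Instr.exec, hk, hs, hD]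
      ring
    · refine .instr_seq (.instr ?_)
      simp [Instr.exec, hr .i rfl, hr .j rfl, hi, hj, h.1, h.2.2]
      ring

/-! ### Binary increment and decrement -/

/-- A lowest bit `0` is set and the loop ends; a lowest bit `1` is cleared and the carry goes into
`a / 2`. The bound on `a + 1` stops the carry inside the block, so other blocks are untouched. -/
theorem incCoord_halts (k a p : ℕ) (hp : s.reg .start = p) (h0 : s.reg .zero = 0)
    (h1 : s.reg .one = 1) (ha : a + 1 < 2 ^ k) (hk : Holds (s.mem .key) p (bitList k a)) :
    Halts incCoord s (4 * k + 4) fun s' => Holds (s'.mem .key) p (bitList k (a + 1)) ∧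
      ∀ q : ℤ, (q < p ∨ p + k ≤ q) → s'.mem .key q = s.mem .key q := by
  -- The induction is on the bits not yet reached, so the claim starts after the prologue, with
  -- `pos` at the current bit and `d` already loaded.
  suffices h : ∀ (k a p : ℕ) (s : MState), s.reg .pos = p → s.reg .d = s.mem .key p →
      s.reg .zero = 0 → s.reg .one = 1 → a + 1 < 2 ^ k → Holds (s.mem .key) p (bitList k a) →
      Halts (.whileNe .d .zero (store .key .pos .zero ;; succ .pos ;; load .d .key .pos) ;;
        store .key .pos .one) s (4 * k + 2) fun s' => Holds (s'.mem .key) p (bitList k (a + 1)) ∧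
        ∀ q : ℤ, (q < p ∨ p + k ≤ q) → s'.mem .key q = s.mem .key q by
    refine .instr_seq (.instr_seq (h k a p _ ?_ ?_ ?_ ?_ ha ?_)) <;> simp [Instr.exec, *]
  clear hp h0 h1 ha hk
  intro k
  induction k with
  | zero => intro a p s _ _ _ _ ha; simp at ha
  | succ k ih =>
    intro a p s hp hd h0 h1 ha hk
    rw [bitList_succ] at hk ⊢
    rw [pow_succ] at ha
    obtain ⟨hk1, hk2⟩ := hk
    rcases Nat.mod_two_eq_zero_or_one a with h | h
    · have e1 : (a + 1) / 2 = a / 2 := by omega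
      have e2 : (a + 1) % 2 = 1 := by omega
      simp only [h, zero_ne_one, decide_false, Bool.false_eq_true, if_false] at hk1
      refine Halts.le (.seq (.whileNe_done (by rw [hd, hk1, h0]) (.instr (Q := _) ⟨⟨?_, ?_⟩, ?_⟩)))
        (by omega)
      · simp [Instr.exec, hp, e2, h1]
      · rw [e1]
        exact hk2.congr fun q hq _ => by
          simp only [Instr.exec, MState.setMem_mem, if_true, hp]
          exact Function.update_of_ne (by omega) _ _
      · intro q hq
        simp only [Instr.exec, MState.setMem_mem, if_true, hp]
        exact Function.update_of_ne (by omega) _ _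
    · have e1 : (a + 1) / 2 = a / 2 + 1 := by omega
      have e2 : (a + 1) % 2 = 0 := by omega
      simp only [h, decide_true, if_true] at hk1
      refine Halts.le (B := 3 + (4 * k + 2) + 1) (.seq_whileNe_step (by rw [hd, hk1, h0]; simp)
        (.instr_seq (.instr_seq (.instr ?_)))) (by omega)
      refine (ih (a / 2) (p + 1) _ ?_ ?_ ?_ ?_ (by omega) ?_).mono le_rfl ?_
      · simp [Instr.exec, hp]
      · simp [Instr.exec, hp]
      · simpa [Instr.exec]
      · simpa [Instr.exec]
      · push_cast
        exact hk2.congr fun q hq _ => by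
          simp only [Instr.exec, MState.setReg_mem, MState.setMem_mem, if_true, hp]
          exact Function.update_of_ne (by omega) _ _
      · rintro s' ⟨h3, h4⟩
        refine ⟨⟨?_, ?_⟩, fun q hq => ?_⟩
        · rw [h4 p (by omega)]
          simp [Instr.exec, hp, e2, h0]
        · rw [e1]
          exact_mod_cast h3
        · rw [h4 q (by omega)]
          simp only [Instr.exec, MState.setReg_mem, MState.setMem_mem, if_true, hp]
          exact Function.update_of_ne (by omega) _ _

end Prog

namespace Prog

variable {s : MState}

/-- Mirror image of the increment. Writing the old value as `a + 1` makes it positive, so the borrow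
meets a bit `1` inside the block. -/
theorem decCoord_halts (k a p : ℕ) (hp : s.reg .start = p) (h0 : s.reg .zero = 0)
    (h1 : s.reg .one = 1) (ha : a + 1 < 2 ^ k) (hk : Holds (s.mem .key) p (bitList k (a + 1))) :
    Halts decCoord s (4 * k + 4) fun s' => Holds (s'.mem .key) p (bitList k a) ∧
      ∀ q : ℤ, (q < p ∨ p + k ≤ q) → s'.mem .key q = s.mem .key q := by
  suffices h : ∀ (k a p : ℕ) (s : MState), s.reg .pos = p → s.reg .d = s.mem .key p →
      s.reg .zero = 0 → s.reg .one = 1 → a + 1 < 2 ^ k →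
      Holds (s.mem .key) p (bitList k (a + 1)) →
      Halts (.whileNe .d .one (store .key .pos .one ;; succ .pos ;; load .d .key .pos) ;;
        store .key .pos .zero) s (4 * k + 2) fun s' => Holds (s'.mem .key) p (bitList k a) ∧
        ∀ q : ℤ, (q < p ∨ p + k ≤ q) → s'.mem .key q = s.mem .key q by
    refine .instr_seq (.instr_seq (h k a p _ ?_ ?_ ?_ ?_ ha ?_)) <;> simp [Instr.exec, *]
  clear hp h0 h1 ha hk
  intro k
  induction k with
  | zero => intro a p s _ _ _ _ ha; simp at ha
  | succ k ih =>
    intro a p s hp hd h0 h1 ha hk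
    rw [bitList_succ] at hk ⊢
    rw [pow_succ] at ha
    obtain ⟨hk1, hk2⟩ := hk
    rcases Nat.mod_two_eq_zero_or_one a with h | h
    · have e1 : (a + 1) / 2 = a / 2 := by omega
      have e2 : (a + 1) % 2 = 1 := by omega
      simp only [e2, decide_true, if_true] at hk1
      rw [e1] at hk2
      refine Halts.le (.seq (.whileNe_done (by rw [hd, hk1, h1]) (.instr (Q := _) ⟨⟨?_, ?_⟩, ?_⟩)))
        (by omega)
      · simp [Instr.exec, hp, h, h0]
      · exact hk2.congr fun q hq _ => by
          simp only [Instr.exec, MState.setMem_mem, if_true, hp]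
          exact Function.update_of_ne (by omega) _ _
      · intro q hq
        simp only [Instr.exec, MState.setMem_mem, if_true, hp]
        exact Function.update_of_ne (by omega) _ _
    · have e1 : (a + 1) / 2 = a / 2 + 1 := by omega
      have e2 : (a + 1) % 2 = 0 := by omega
      simp only [e2, zero_ne_one, decide_false, Bool.false_eq_true, if_false] at hk1
      rw [e1] at hk2
      refine Halts.le (B := 3 + (4 * k + 2) + 1) (.seq_whileNe_step (by rw [hd, hk1, h1]; simp)
        (.instr_seq (.instr_seq (.instr ?_)))) (by omega)
      refine (ih (a / 2) (p + 1) _ ?_ ?_ ?_ ?_ (by omega) ?_).mono le_rfl ?_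
      · simp [Instr.exec, hp]
      · simp [Instr.exec, hp]
      · simpa [Instr.exec]
      · simpa [Instr.exec]
      · push_cast
        exact hk2.congr fun q hq _ => by
          simp only [Instr.exec, MState.setReg_mem, MState.setMem_mem, if_true, hp]
          exact Function.update_of_ne (by omega) _ _
      · rintro s' ⟨h3, h4⟩
        refine ⟨⟨?_, ?_⟩, fun q hq => ?_⟩
        · rw [h4 p (by omega)]
          simp [Instr.exec, hp, h, h1]
        · exact_mod_cast h3
        · rw [h4 q (by omega)]
          simp only [Instr.exec, MState.setReg_mem, MState.setMem_mem, if_true, hp]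
          exact Function.update_of_ne (by omega) _ _

end Prog

/-! ## Tries in memory -/

namespace MState

/-- The array of the pointers to the children in the direction `b`. -/
abbrev side (b : Bool) : Arr := if b then .right else .left

/-- Descent is defined from the root end, but nodes are attached at the far end of a path, so the
recursion on the last label is needed. -/
theorem descend_snoc (s : MState) (x : ℤ) (bs : List Bool) (b : Bool) :
    s.descend x (bs ++ [b]) = (s.descend x bs).bind fun y =>
      if s.mem (side b) y = 0 then none else some (s.mem (side b) y) := by
  induction bs generalizing x with
  | nil => rfl
  | cons c bs ih =>
    simp only [List.cons_append, descend, ih]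
    by_cases h : s.mem (side c) x = 0 <;> simp [h]

theorem descend_congr {s s' : MState} (hl : s'.mem .left = s.mem .left)
    (hr : s'.mem .right = s.mem .right) (x : ℤ) (bs : List Bool) :
    s'.descend x bs = s.descend x bs := by
  induction bs generalizing x with
  | nil => rfl
  | cons c bs ih => cases c <;> simp [descend, hl, hr, ih]

/-- The nodes `0, …, c` in the memory form a trie, in which the path labeled by `bs` ends in the
value `f bs`; here `f bs = 0` for the words `bs` that do not label a path. -/
structure IsTrie (s : MState) (c : ℕ) (f : List Bool → ℤ) : Prop where
  range : ∀ bs x, s.descend 0 bs = some x → 0 ≤ x ∧ x ≤ c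
  inj : ∀ bs cs x, s.descend 0 bs = some x → s.descend 0 cs = some x → bs = cs
  surj : ∀ x : ℤ, 0 ≤ x → x ≤ c → ∃ bs, s.descend 0 bs = some x
  fresh : ∀ x : ℤ, c < x → s.mem .left x = 0 ∧ s.mem .right x = 0 ∧ s.mem .val x = 0
  val : ∀ bs x, s.descend 0 bs = some x → s.mem .val x = f bs
  none : ∀ bs, s.descend 0 bs = none → f bs = 0

namespace IsTrie

variable {s s' : MState} {c : ℕ} {f : List Bool → ℤ}

theorem congr (h : s.IsTrie c f) (hl : s'.mem .left = s.mem .left)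
    (hr : s'.mem .right = s.mem .right) (hv : s'.mem .val = s.mem .val) : s'.IsTrie c f := by
  obtain ⟨h1, h2, h3, h4, h5, h6⟩ := h
  constructor <;> simp only [descend_congr hl hr, hl, hr, hv] <;> assumption

theorem empty (h : ∀ A x, A ≠ .idx → A ≠ .eps → A ≠ .key → s.mem A x = 0) : s.IsTrie 0 0 := by
  have hd : ∀ bs, s.descend 0 bs = if bs = [] then some 0 else Option.none := by
    intro bs
    cases bs with
    | nil => rfl
    | cons b bs => cases b <;> simp [descend, h]
  constructor
  · intro bs x hx
    rw [hd] at hx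
    split_ifs at hx
    obtain rfl := Option.some.inj hx
    simp
  · intro bs cs x hx hy
    rw [hd] at hx hy
    split_ifs at hx hy
    simp_all
  · intro x h1 h2
    exact ⟨[], by rw [hd, if_pos rfl, show x = 0 by push_cast at h2; omega]⟩
  · intro x _
    simp [h]
  · intro bs x _
    simp [h]
  · simp

/-- For `v ≠ 0` a missing path and a path ending in `0` both fail, so `f` need not distinguish them.
-/
theorem lookup_eq_some_iff (h : s.IsTrie c f) {bs : List Bool} {v : ℤ} (hv : v ≠ 0) :
    s.lookup bs = some v ↔ f bs = v := by
  unfold lookup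
  cases hd : s.descend 0 bs with
  | none => simp [h.none bs hd, hv.symm]
  | some x => simp [h.val bs x hd]

/-- Adding a leaf. -/
theorem addLeaf (h : s.IsTrie c f) {bs : List Bool} {x : ℤ} {b : Bool}
    (hx : s.descend 0 bs = some x) (h0 : s.mem (side b) x = 0) :
    (s.setMem (side b) x (c + 1)).IsTrie (c + 1) f ∧
      (s.setMem (side b) x (c + 1)).descend 0 (bs ++ [b]) = some (c + 1 : ℤ) := by
  have hc : ∀ a y, (s.setMem (side b) x (c + 1)).mem (side a) y =
      if a = b ∧ y = x then (c + 1 : ℤ) else s.mem (side a) y := by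
    intro a y
    cases a <;> cases b <;> simp [side, Function.update_apply]
  have hnone : s.descend 0 (bs ++ [b]) = Option.none := by
    simp [descend_snoc, hx, h0]
  have hxc := h.range bs x hx
  have hfr : ∀ a, s.mem (side a) (c + 1) = 0 := by
    have := h.fresh (c + 1) (by omega)
    intro a
    cases a
    · exact this.1
    · exact this.2.1
  -- Descent changes at a single word: by injectivity only `bs` reaches `x`, and the new node has no
  -- children since its cells are fresh. All the trie properties follow from this formula.
  have hd : ∀ cs, (s.setMem (side b) x (c + 1)).descend 0 cs =
      if cs = bs ++ [b] then some (c + 1 : ℤ) else s.descend 0 cs := by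
    intro cs
    induction cs using List.reverseRecOn with
    | nil => simp [descend]
    | append_singleton cs a ih =>
      rw [descend_snoc, ih]
      by_cases hcs : cs = bs ++ [b]
      · subst hcs
        rw [if_pos rfl, if_neg (by simp), descend_snoc, hnone]
        have hn : ¬ (a = b ∧ (c + 1 : ℤ) = x) := by omega
        simp [hc, hfr, hn]
      · rw [if_neg hcs]
        by_cases he : cs ++ [a] = bs ++ [b]
        · obtain ⟨rfl, he2⟩ := List.append_inj' he rfl
          obtain rfl : a = b := by simpa using he2
          simp [hx, hc]
          omega
        · rw [if_neg he, descend_snoc]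
          cases hcd : s.descend 0 cs with
          | none => rfl
          | some y =>
            have hn : ¬ (a = b ∧ y = x) := by
              rintro ⟨rfl, rfl⟩
              exact he (by rw [h.inj _ _ _ hcd hx])
            simp only [Option.bind_some, hc, hn, if_false]
  have hv : (s.setMem (side b) x (c + 1)).mem .val = s.mem .val := by
    cases b <;> simp [side]
  refine ⟨⟨?_, ?_, ?_, ?_, ?_, ?_⟩, by rw [hd, if_pos rfl]⟩
  · intro cs y hy
    rw [hd] at hy
    split_ifs at hy
    · obtain rfl := Option.some.inj hy
      push_cast
      omega
    · have := h.range cs y hy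
      push_cast
      omega
  · intro cs ds y hy hz
    rw [hd] at hy hz
    split_ifs at hy hz with h1 h2 h2
    · rw [h1, h2]
    · have := h.range _ _ hz
      have := Option.some.inj hy
      omega
    · have := h.range _ _ hy
      have := Option.some.inj hz
      omega
    · exact h.inj _ _ _ hy hz
  · intro y hy1 hy2
    by_cases hy : y = c + 1
    · exact ⟨bs ++ [b], by rw [hd, if_pos rfl, hy]⟩
    · push_cast at hy2
      obtain ⟨cs, hcs⟩ := h.surj y hy1 (by omega)
      refine ⟨cs, ?_⟩
      rw [hd, if_neg, hcs]
      rintro rfl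
      simp [hnone] at hcs
  · intro y hy
    push_cast at hy
    have h1 := h.fresh y (by omega)
    have h2 := hc false y
    have h3 := hc true y
    rw [if_neg (by omega)] at h2 h3
    exact ⟨h2.trans h1.1, h3.trans h1.2.1, by rw [hv]; exact h1.2.2⟩
  · intro cs y hy
    rw [hd] at hy
    rw [hv]
    split_ifs at hy with h1
    · obtain rfl := Option.some.inj hy
      rw [h1, h.none _ hnone]
      exact (h.fresh (c + 1) (by omega)).2.2
    · exact h.val cs y hy
  · intro cs hcs
    rw [hd] at hcs
    split_ifs at hcs
    exact h.none cs hcs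

/-- Changing a value. -/
theorem setVal (h : s.IsTrie c f) {bs : List Bool} {x : ℤ} (a : ℤ)
    (hx : s.descend 0 bs = some x) :
    (s.setMem .val x a).IsTrie c (Function.update f bs a) := by
  have hd : ∀ cs, (s.setMem .val x a).descend 0 cs = s.descend 0 cs :=
    descend_congr (by simp) (by simp) 0
  refine ⟨?_, ?_, ?_, ?_, ?_, ?_⟩ <;> try simp only [hd]
  · exact h.range
  · exact h.inj
  · exact h.surj
  · intro y hy
    have := h.range _ _ hx
    have hyx : y ≠ x := by omega
    simpa [hyx] using h.fresh y hy
  · intro cs y hy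
    by_cases hcs : cs = bs
    · subst hcs
      obtain rfl := Option.some.inj (hx.symm.trans hy)
      simp
    -- Distinct words end in distinct nodes, so the write affects no other value.
    · have hyx : y ≠ x := by
        rintro rfl
        exact hcs (h.inj _ _ _ hy hx)
      simp [hyx, hcs, h.val cs y hy]
  · intro cs hcs
    have hcb : cs ≠ bs := by
      rintro rfl
      simp [hcs] at hx
    rw [Function.update_of_ne hcb, h.none cs hcs]

end IsTrie

end MState

/-! ### Walking along a key and scanning the trie -/

namespace Prog

variable {s : MState}

/-- `walk` reaches the end of the path labeled by the key `bs`, and preserves the values. -/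
theorem walk_halts {c : ℕ} {f : List Bool → ℤ} (bs : List Bool) (h : s.IsTrie c f)
    (hc : s.reg .count = c) (h0 : s.reg .zero = 0) (he : s.reg .keyEnd = bs.length)
    (hk : Holds (s.mem .key) 0 bs) :
    Halts walk s (11 * bs.length + 3) fun s' => ∃ c' : ℕ, c' ≤ c + bs.length ∧
      s'.reg .count = c' ∧ s'.IsTrie c' f ∧ s'.descend 0 bs = some (s'.reg .node) := by
  -- `ds` has been read and `es` remains; each bit costs at most ten steps and one test, and creates
  -- at most one node.
  refine .instr_seq (.instr_seq (.whileNe (fun n s => s.reg .zero = 0 ∧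
    s.reg .keyEnd = bs.length ∧ Holds (s.mem .key) 0 bs ∧ ∃ (ds es : List Bool) (c' : ℕ),
      bs = ds ++ es ∧ s.reg .pos = ds.length ∧ c' ≤ c + ds.length ∧ s.reg .count = c' ∧
      s.IsTrie c' f ∧ s.descend 0 ds = some (s.reg .node) ∧ n = 11 * es.length) ?_ ?_ ?_))
  · refine ⟨?_, ?_, ?_, [], bs, c, ?_⟩
    · simp [Instr.exec, h0]
    · simp [Instr.exec, he]
    · simpa [Instr.exec]
    · refine ⟨rfl, ?_, ?_, ?_, h.congr ?_ ?_ ?_, ?_, rfl⟩ <;> simp [Instr.exec, hc, MState.descend]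
  · rintro n s ⟨h0, he, hk, ds, es, c', rfl, hp, hc', hc, ht, hd, -⟩ hx
    obtain rfl : es = [] := by
      rw [← List.length_eq_zero_iff]
      rw [hp, he, List.length_append] at hx
      omega
    rw [List.append_nil]
    exact ⟨c', hc', hc, ht, hd⟩
  · rintro n s ⟨h0, he, hk, ds, es, c', rfl, hp, hc', hc, ht, hd, hn⟩ hx
    obtain _ | ⟨b, es⟩ := es
    · simp [hp, he] at hx
    refine ⟨10, 11 * es.length, by simp [hn]; omega, ?_⟩
    have hk' := (holds_append.1 hk).2.1
    rw [zero_add] at hk'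
    refine .instr_seq (B := 9) (.seq_of (B := 2) (B' := 7) (P := fun s' =>
      s'.reg .child = s.mem (MState.side b) (s.reg .node)) (.ifEq ?_) fun s₁ hch hr₁ hm₁ => ?_)
    · cases b <;> simp [Instr.exec, hp, hk', h0] <;> exact .instr (by simp [Instr.exec, MState.side])
    have h0₁ := hr₁ .zero rfl
    have he₁ := hr₁ .keyEnd rfl
    have hp₁ := hr₁ .pos rfl
    have hc₁ := hr₁ .count rfl
    have hd₁ := hr₁ .d rfl
    have hn₁ := hr₁ .node rfl
    simp [Instr.exec, h0, he, hp, hc, hk'] at h0₁ he₁ hp₁ hc₁ hd₁ hn₁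
    have ht₁ : s₁.IsTrie c' f := ht.congr (hm₁ .left rfl) (hm₁ .right rfl) (hm₁ .val rfl)
    have hx₁ : s₁.descend 0 ds = some (s₁.reg .node) := by
      rw [MState.descend_congr (s := s) (hm₁ .left rfl) (hm₁ .right rfl), hn₁]
      exact hd
    have hch₁ : s₁.reg .child = s₁.mem (MState.side b) (s₁.reg .node) := by
      rw [hch, hn₁]
      cases b
      · exact congrFun (hm₁ .left rfl).symm _
      · exact congrFun (hm₁ .right rfl).symm _
    have hk₁ : Holds (s₁.mem .key) 0 (ds ++ b :: es) := by
      rw [hm₁ .key rfl]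
      exact hk
    clear hr₁ hm₁ hch hx h0 he hk hp hc ht hd hk'
    refine .seq_of (B := 5) (B' := 2) (P := fun s' => ∃ c'' : ℕ, c'' ≤ c' + 1 ∧ s'.reg .count = c'' ∧
      s'.IsTrie c'' f ∧ s'.descend 0 (ds ++ [b]) = some (s'.reg .child)) (.ifEq ?_)
      fun s₂ h₂ hr₂ hm₂ => ?_
    · split_ifs with hif
      · rw [h0₁, hch₁] at hif
        -- The represented function `f` is unchanged: it is `0` on absent words and the new leaf has
        -- the value `0`.
        obtain ⟨ht₂, hd₂⟩ := ht₁.addLeaf hx₁ hif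
        refine .instr_seq (.instr_seq (.ifEq (B := 1) ?_))
        cases b <;> simp [Instr.exec, hd₁, h0₁] <;> refine .instr ⟨c' + 1, le_rfl, ?_, ?_, ?_⟩
        · simp [Instr.exec, hc₁]
        · refine ht₂.congr ?_ ?_ ?_ <;> simp [Instr.exec, hc₁, MState.side]
        · refine (MState.descend_congr ?_ ?_ _ _).trans (hd₂.trans ?_) <;>
            simp [Instr.exec, hc₁, MState.side]
        · simp [Instr.exec, hc₁]
        · refine ht₂.congr ?_ ?_ ?_ <;> simp [Instr.exec, hc₁, MState.side]
        · refine (MState.descend_congr ?_ ?_ _ _).trans (hd₂.trans ?_) <;>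
            simp [Instr.exec, hc₁, MState.side]
      · rw [h0₁, hch₁] at hif
        refine Halts.le (.instr ⟨c', by omega, ?_, ht₁.congr ?_ ?_ ?_, ?_⟩) (by omega)
        · simp [Instr.exec, hc₁]
        iterate 3 simp [Instr.exec]
        · rw [MState.descend_congr (s := s₁) (by simp [Instr.exec]) (by simp [Instr.exec]),
            MState.descend_snoc, hx₁]
          simp [hif, Instr.exec, hch₁]
    · obtain ⟨c'', hc'', hc₂, ht₂, hd₂⟩ := h₂
      refine .instr_seq (.instr ⟨?_, ?_, ?_, ds ++ [b], es, c'', ?_, ?_, ?_, ?_, ?_, ?_, rfl⟩)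
      · simp [Instr.exec, hr₂ .zero rfl, h0₁]
      · simp [Instr.exec, hr₂ .keyEnd rfl, he₁]
      · simpa [Instr.exec, hm₂ .key rfl] using hk₁
      · simp
      · simp [Instr.exec, hr₂ .pos rfl, hp₁]
      · simp
        omega
      · simp [Instr.exec, hc₂]
      · refine ht₂.congr ?_ ?_ ?_ <;> simp [Instr.exec]
      · rw [MState.descend_congr (s := s₂) (by simp [Instr.exec]) (by simp [Instr.exec]), hd₂]
        simp [Instr.exec]

/-- The answer is `1` if all values in the trie are `0`, and `0` otherwise. -/
theorem checkProgram_halts {c : ℕ} {f : List Bool → ℤ} (h : s.IsTrie c f)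
    (hc : s.reg .count = c) (h0 : s.reg .zero = 0) (h1 : s.reg .one = 1) (hf : f [] = 0) :
    Halts checkProgram s (5 * c + 3) fun s' =>
      (s'.reg .answer = 1 ∧ f = 0) ∨ (s'.reg .answer = 0 ∧ f ≠ 0) := by
  refine .instr_seq (.instr_seq (Halts.mono (B := c * (4 + 1) + 1) (Halts.whileNe_count c 4
    (fun k s => s.reg .count = c ∧ s.reg .zero = 0 ∧ s.reg .node = k ∧ s.IsTrie c f ∧
      (s.reg .answer = 1 ∧ (∀ x : ℤ, 0 < x → x ≤ k → s.mem .val x = 0) ∨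
        s.reg .answer = 0 ∧ ∃ x : ℤ, 0 < x ∧ x ≤ k ∧ s.mem .val x ≠ 0)) ?_ ?_ ?_)
    (by omega) ?_))
  · refine ⟨?_, ?_, ?_, h.congr ?_ ?_ ?_, ?_⟩ <;> simp [Instr.exec, hc, h0, h1]
    omega
  · rintro k s - ⟨hc, -, hk, -⟩
    rw [hc, hk]
    omega
  · rintro k s hkc ⟨hc, h0, hk, ht, ha⟩
    have hcast : ∀ x : ℤ, x ≤ (k + 1 : ℕ) ↔ x ≤ k ∨ x = k + 1 := by
      intro x
      push_cast
      omega
    refine .instr_seq (.instr_seq (.ifEq ?_))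
    split_ifs with hv <;> simp [Instr.exec, hk, h0] at hv <;>
      refine .instr ⟨?_, ?_, ?_, ht.congr ?_ ?_ ?_, ?_⟩
    iterate 2 simp [Instr.exec, hc, h0]
    · simp [Instr.exec, hk]
    iterate 3 simp [Instr.exec]
    · simp only [hcast, Instr.exec, MState.setReg_reg, MState.setReg_mem, reduceCtorEq, if_false]
      rcases ha with ⟨ha, hx⟩ | ⟨ha, x, hx⟩
      · refine .inl ⟨ha, ?_⟩
        rintro x hx0 (hx1 | rfl)
        · exact hx x hx0 hx1
        · exact hv
      · exact .inr ⟨ha, x, hx.1, .inl hx.2.1, hx.2.2⟩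
    iterate 2 simp [Instr.exec, hc, h0]
    · simp [Instr.exec, hk]
    iterate 3 simp [Instr.exec]
    · refine .inr ⟨by simp [Instr.exec], k + 1, by omega, by simp, ?_⟩
      simpa [Instr.exec] using hv
  · rintro s ⟨-, -, -, ht, ha⟩
    rcases ha with ⟨ha, hx⟩ | ⟨ha, x, hx0, hx1, hx⟩
    · refine .inl ⟨ha, funext fun bs => ?_⟩
      cases hd : s.descend 0 bs with
      | none => exact ht.none bs hd
      | some x =>
        have hr := ht.range bs x hd
        rw [← ht.val bs x hd]
        rcases hr.1.eq_or_lt with h | h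
        -- The scan skips the root, which only the empty word reaches; there the assumption on `f
        -- []` is used.
        · obtain rfl : bs = [] := ht.inj _ _ x hd (by rw [← h]; rfl)
          rw [ht.val [] x hd, hf]
          rfl
        · exact hx x h hr.2
    · refine .inr ⟨ha, fun h => hx ?_⟩
      obtain ⟨bs, hbs⟩ := ht.surj x hx0.le hx1
      rw [ht.val bs x hbs, h]
      rfl

end Prog

/-! ## The codes of the pairs -/

/-- The first part of the code of a pair `(δ, i)`. -/
def vecCode {r : ℕ} (D : ℕ) (δ : Fin r → ℤ) : List Bool :=
  (List.ofFn δ).flatMap fun a => bitList (D + 1) (a + 2 ^ D).toNat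

theorem pairCode_eq {r : ℕ} (n : ℕ) (δ : Fin r → ℤ) (i : Fin r) :
    pairCode n δ i = vecCode (Nat.clog 2 (n + 1)) δ ++ bitList (Nat.clog 2 r) i := rfl

@[simp] theorem length_vecCode {r : ℕ} (D : ℕ) (δ : Fin r → ℤ) :
    (vecCode D δ).length = r * (D + 1) := by
  simp [vecCode, List.length_flatMap, Function.comp_def]

theorem vecCode_zero (r D : ℕ) :
    vecCode D (0 : Fin r → ℤ) = (List.replicate r (bitList (D + 1) (2 ^ D))).flatten := by
  have h : (2 ^ D : ℤ).toNat = 2 ^ D := by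
    rw [show (2 ^ D : ℤ) = ((2 ^ D : ℕ) : ℤ) by push_cast; rfl, Int.toNat_natCast]
  have h' : List.ofFn (0 : Fin r → ℤ) = List.replicate r 0 := List.ofFn_const r 0
  simp [vecCode, h', List.flatMap, h]

theorem holds_flatMap {α : Type*} {m : ℤ → ℤ} {p : ℤ} {L : ℕ} {f : α → List Bool}
    (hf : ∀ a, (f a).length = L) {l : List α} :
    Holds m p (l.flatMap f) ↔ ∀ (j : ℕ) (hj : j < l.length), Holds m (p + j * L) (f l[j]) := by
  induction l generalizing p with
  | nil => simp [Holds]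
  | cons a l ih =>
    rw [List.flatMap_cons, holds_append, ih, hf]
    constructor
    · rintro ⟨h1, h2⟩ (_ | j) hj
      · simpa using h1
      · have := h2 j (by simpa using hj)
        simp only [List.getElem_cons_succ]
        convert this using 1
        push_cast
        ring
    · intro h
      have h0 := h 0 (by simp)
      rw [Nat.cast_zero, zero_mul, add_zero] at h0
      refine ⟨h0, fun j hj => ?_⟩
      have := h (j + 1) (by simpa using hj)
      simp only [List.getElem_cons_succ] at this
      convert this using 1
      push_cast
      ring

theorem holds_vecCode {r D : ℕ} {m : ℤ → ℤ} {δ : Fin r → ℤ} :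
    Holds m 0 (vecCode D δ) ↔
      ∀ j : Fin r, Holds m (j * (D + 1) : ℕ) (bitList (D + 1) (δ j + 2 ^ D).toNat) := by
  rw [vecCode, holds_flatMap (L := D + 1) (fun a => length_bitList _ _)]
  constructor
  · intro h j
    simpa using h j (by simp)
  · intro h j hj
    simpa using h ⟨j, by simpa using hj⟩

/-- Rewriting the block of one coordinate. -/
theorem holds_update {r D : ℕ} {m m' : ℤ → ℤ} {δ : Fin r → ℤ} {cs : List Bool} (i : Fin r) {a : ℤ}
    (h : Holds m 0 (vecCode D δ ++ cs))
    (hi : Holds m' (i * (D + 1) : ℕ) (bitList (D + 1) (a + 2 ^ D).toNat))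
    (hm : ∀ q : ℤ, (q < (i * (D + 1) : ℕ) ∨ (i * (D + 1) : ℕ) + (D + 1 : ℕ) ≤ q) → m' q = m q) :
    Holds m' 0 (vecCode D (Function.update δ i a) ++ cs) := by
  have hle : ∀ {j k : ℕ}, j < k → j * (D + 1) + (D + 1) ≤ k * (D + 1) := fun {j k} hjk => by
    rw [← Nat.succ_mul]
    exact Nat.mul_le_mul_right _ hjk
  rw [holds_append] at h ⊢
  refine ⟨holds_vecCode.2 fun j => ?_, ?_⟩
  · by_cases hj : j = i
    · subst hj
      simpa using hi
    · rw [Function.update_of_ne hj]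
      refine (holds_vecCode.1 h.1 j).congr fun q h1 h2 => hm q ?_
      rw [length_bitList] at h2
      rcases lt_or_gt_of_ne (Fin.val_ne_of_ne hj) with h' | h'
      · have := hle h'
        omega
      · have := hle h'
        omega
  · rw [length_vecCode] at h ⊢
    refine h.2.congr fun q h1 h2 => hm q ?_
    have := hle i.2
    omega

/-- Blocks have equal length, so the concatenation parses uniquely, and the shift by `2 ^ D` sends
the allowed coordinates into `(0, 2 ^ (D + 1))`, where `D + 1` digits are faithful. -/
theorem vecCode_injOn {r D : ℕ} {δ ε : Fin r → ℤ} (hδ : ∀ j, |δ j| < 2 ^ D)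
    (hε : ∀ j, |ε j| < 2 ^ D) (h : vecCode D δ = vecCode D ε) : δ = ε := by
  have key : ∀ l l' : List ℤ, l.length = l'.length →
      (l.flatMap fun a => bitList (D + 1) (a + 2 ^ D).toNat) =
        (l'.flatMap fun a => bitList (D + 1) (a + 2 ^ D).toNat) →
      l.map (fun a => bitList (D + 1) (a + 2 ^ D).toNat) =
        l'.map fun a => bitList (D + 1) (a + 2 ^ D).toNat := by
    intro l
    induction l with
    | nil => intro l' h _; rw [List.length_eq_zero_iff.1 h.symm]
    | cons a l ih =>
      rintro (_ | ⟨b, l'⟩) h h'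
      · simp at h
      · rw [List.flatMap_cons, List.flatMap_cons] at h'
        obtain ⟨h1, h2⟩ := List.append_inj h' (by simp)
        rw [List.map_cons, List.map_cons, h1, ih l' (by simpa using h) h2]
  have h2 := key _ _ (by simp) h
  rw [List.map_ofFn, List.map_ofFn] at h2
  ext j
  have h3 := congrFun (List.ofFn_injective h2) j
  have h4 := abs_lt.1 (hδ j)
  have h5 := abs_lt.1 (hε j)
  have h6 : (2 : ℤ) ^ D = ((2 ^ D : ℕ) : ℤ) := by push_cast; rfl
  rw [h6] at h4 h5
  simp only [Function.comp_apply, h6] at h3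
  have := bitList_injOn (by rw [pow_succ]; omega) (by rw [pow_succ]; omega) h3
  omega

theorem lt_two_pow_clog (n : ℕ) : n < 2 ^ Nat.clog 2 (n + 1) :=
  Nat.le_pow_clog one_lt_two (n + 1)

theorem pairCode_injOn {r n : ℕ} {δ ε : Fin r → ℤ} {i j : Fin r} (hδ : ∀ j, |δ j| ≤ n)
    (hε : ∀ j, |ε j| ≤ n) (h : pairCode n δ i = pairCode n ε j) : δ = ε ∧ i = j := by
  have hn : (n : ℤ) < 2 ^ Nat.clog 2 (n + 1) := by exact_mod_cast lt_two_pow_clog n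
  have hr := Nat.le_pow_clog one_lt_two r
  rw [pairCode_eq, pairCode_eq] at h
  obtain ⟨h1, h2⟩ := List.append_inj h (by simp)
  exact ⟨vecCode_injOn (fun j => (hδ j).trans_lt hn) (fun j => (hε j).trans_lt hn) h1,
    Fin.ext (bitList_injOn (i.2.trans_le hr) (j.2.trans_le hr) h2)⟩

/-! ## The finite map of the Fox derivatives -/

/-- `f` is the function on binary words which corresponds to the map `(δ, i) ↦ m_{δ,i}`. -/
structure IsFoxMap {r : ℕ} (n : ℕ) (u : FreeGroup (Fin r)) (f : List Bool → ℤ) : Prop where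
  apply_pairCode : ∀ (δ : Fin r → ℤ) i, (∀ j, |δ j| ≤ n) → f (pairCode n δ i) = foxCoeff u δ i
  exists_of_ne : ∀ bs, f bs ≠ 0 → ∃ (δ : Fin r → ℤ) (i : Fin r), (∀ j, |δ j| ≤ n) ∧ bs = pairCode n δ i
  bound : ∀ δ i, foxCoeff u δ i ≠ 0 → ∀ j, |δ j| ≤ n

namespace IsFoxMap

variable {r n : ℕ} {u u' : FreeGroup (Fin r)} {f : List Bool → ℤ}

theorem one : IsFoxMap n (1 : FreeGroup (Fin r)) 0 :=
  ⟨fun δ i _ => by simp [foxCoeff_one], fun bs h => by simp at h,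
    fun δ i h => by simp [foxCoeff_one] at h⟩

/-- Injectivity of the code on bounded vectors ensures that changing one key changes only one
coefficient. -/
theorem update (h : IsFoxMap n u f) {δ₀ : Fin r → ℤ} {a : Fin r} {e : ℤ} (hδ₀ : ∀ j, |δ₀ j| ≤ n)
    (hu : ∀ δ i, foxCoeff u' δ i = foxCoeff u δ i + if δ = δ₀ ∧ i = a then e else 0) :
    IsFoxMap n u' (Function.update f (pairCode n δ₀ a) (f (pairCode n δ₀ a) + e)) := by
  refine ⟨fun δ i hδ => ?_, fun bs hbs => ?_, fun δ i h' => ?_⟩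
  · rw [hu]
    split_ifs with hc
    · obtain ⟨rfl, rfl⟩ := hc
      rw [Function.update_self, h.apply_pairCode _ _ hδ]
    · rw [Function.update_of_ne fun he => hc (pairCode_injOn hδ hδ₀ he), h.apply_pairCode _ _ hδ,
        add_zero]
  · by_cases hb : bs = pairCode n δ₀ a
    · exact ⟨δ₀, a, hδ₀, hb⟩
    · rw [Function.update_of_ne hb] at hbs
      exact h.exists_of_ne bs hbs
  · rw [hu] at h'
    split_ifs at h' with hc
    · rw [hc.1]
      exact hδ₀
    · rw [add_zero] at h'
      exact h.bound δ i h'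

theorem apply_eq_iff (h : IsFoxMap n u f) {bs : List Bool} {v : ℤ} (hv : v ≠ 0) :
    f bs = v ↔ ∃ δ i, bs = pairCode n δ i ∧ foxCoeff u δ i = v := by
  constructor
  · intro hf
    obtain ⟨δ, i, hδ, hbs⟩ := h.exists_of_ne bs (by rwa [hf])
    exact ⟨δ, i, hbs, by rw [← h.apply_pairCode δ i hδ, ← hbs, hf]⟩
  · rintro ⟨δ, i, rfl, hf⟩
    rw [h.apply_pairCode δ i (h.bound δ i (by rwa [hf])), hf]

theorem eq_zero_iff (h : IsFoxMap n u f) : f = 0 ↔ ∀ i, foxDerivAb i u = 0 := by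
  rw [foxDerivAb_eq_zero_iff]
  constructor
  · intro hf δ i
    by_contra hne
    apply hne
    rw [← h.apply_pairCode δ i (h.bound δ i hne), hf]
    rfl
  · intro hc
    ext bs
    by_contra hne
    obtain ⟨δ, i, hδ, hbs⟩ := h.exists_of_ne bs hne
    exact hne (by rw [hbs, h.apply_pairCode δ i hδ, hc]; rfl)

/-- A pair `(δ, i)` exists only if `r ≥ 1`, and then its code contains a nonempty block. Hence
skipping the root in the scan is sound. -/
theorem apply_nil (h : IsFoxMap n u f) : f [] = 0 := by
  by_contra hne
  obtain ⟨δ, i, -, hbs⟩ := h.exists_of_ne [] hne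
  have := congrArg List.length hbs
  rw [pairCode_eq, List.length_append, length_vecCode, List.length_nil] at this
  have := Nat.mul_pos i.pos (by omega : 0 < Nat.clog 2 (n + 1) + 1)
  omega

end IsFoxMap

theorem mk_append_singleton {r : ℕ} (w : List (Fin r × Bool)) (i : Fin r) (b : Bool) :
    FreeGroup.mk (w ++ [(i, b)]) =
      FreeGroup.mk w * if b then FreeGroup.of i else (FreeGroup.of i)⁻¹ := by
  cases b <;> simp [FreeGroup.of, FreeGroup.inv_mk, FreeGroup.mul_mk, FreeGroup.invRev]

theorem abs_expVec_mk_le {r : ℕ} (w : List (Fin r × Bool)) (j : Fin r) :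
    |expVec (FreeGroup.mk w) j| ≤ w.length := by
  induction w using List.reverseRecOn with
  | nil => simp [← FreeGroup.one_eq_mk, expVec_one]
  | append_singleton w a ih =>
    obtain ⟨i, b⟩ := a
    rw [mk_append_singleton, expVec_mul, Pi.add_apply]
    refine (abs_add_le _ _).trans ?_
    have : |expVec (if b then FreeGroup.of i else (FreeGroup.of i)⁻¹) j| ≤ 1 := by
      cases b <;> by_cases h : j = i <;> simp [expVec_inv, expVec_of, h]
    simp only [List.length_append, List.length_singleton, Nat.cast_add, Nat.cast_one]
    omega

theorem add_single_eq_update {r : ℕ} (δ : Fin r → ℤ) (i : Fin r) (a : ℤ) :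
    δ + Pi.single i a = Function.update δ i (δ i + a) := by
  ext j
  by_cases h : j = i
  · subst h
    simp
  · simp [h]

/-! ### The effect and cost of a single letter -/

namespace Prog

variable {s : MState} {r D k c n : ℕ} {f : List Bool → ℤ} {δ : Fin r → ℤ} {i : Fin r}

/-- The letter `x_i`: the key is used before `δ` moves. The bounds on both values rule out overflow
of the block. Only the vector part of the key is tracked afterwards, since the index part is
rewritten for every letter. -/
theorem walk_addOne_incCoord_halts (ht : s.IsTrie c f) (hc : s.reg .count = c)
    (h0 : s.reg .zero = 0) (h1 : s.reg .one = 1) (he : s.reg .keyEnd = (r * (D + 1) + k : ℕ))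
    (hs : s.reg .start = (i * (D + 1) : ℕ))
    (hk : Holds (s.mem .key) 0 (vecCode D δ ++ bitList k i))
    (hδ : |δ i| < 2 ^ D) (hδ' : |δ i + 1| < 2 ^ D) :
    Halts (walk ;; load .v .val .node ;; succ .v ;; store .val .node .v ;; incCoord) s
      (11 * (r * (D + 1) + k) + 3 + (4 * (D + 1) + 7)) fun s' =>
      (∃ c' : ℕ, c' ≤ c + (r * (D + 1) + k) ∧ s'.reg .count = c' ∧
        s'.IsTrie c' (Function.update f (vecCode D δ ++ bitList k i)
          (f (vecCode D δ ++ bitList k i) + 1))) ∧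
      Holds (s'.mem .key) 0 (vecCode D (Function.update δ i (δ i + 1))) := by
  have hlen : (vecCode D δ ++ bitList k i).length = r * (D + 1) + k := by simp
  have hw := walk_halts _ ht hc h0 (by rw [hlen]; exact he) hk
  rw [hlen] at hw
  refine hw.seq_of fun s₁ h₁ hr₁ hm₁ => ?_
  obtain ⟨c', hc', hc₁, ht₁, hd₁⟩ := h₁
  have h0₁ := hr₁ .zero rfl
  have h1₁ := hr₁ .one rfl
  have hs₁ := hr₁ .start rfl
  have hk₁ := hm₁ .key rfl
  rw [h0] at h0₁
  rw [h1] at h1₁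
  rw [hs] at hs₁
  have h6 : (2 : ℤ) ^ D = ((2 ^ D : ℕ) : ℤ) := by push_cast; rfl
  have h4 := abs_lt.1 hδ
  have h5 := abs_lt.1 hδ'
  rw [h6] at h4 h5
  have hblock := holds_vecCode.1 (holds_append.1 hk).1 i
  rw [← hk₁] at hblock
  refine .instr_seq (.instr_seq (.instr_seq (Halts.mono (Halts.frame (incCoord_halts (D + 1)
    (δ i + 2 ^ D).toNat (i * (D + 1)) ?_ ?_ ?_ ?_ ?_)) le_rfl ?_)))
  · simp [Instr.exec, hs₁]
  · simp [Instr.exec, h0₁]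
  · simp [Instr.exec, h1₁]
  · rw [pow_succ, h6]
    omega
  · simpa [Instr.exec] using hblock
  · rintro s₂ ⟨⟨hk₂, ho₂⟩, hr₂, hm₂⟩
    refine ⟨⟨c', hc', ?_, (ht₁.setVal (f _ + 1) hd₁).congr ?_ ?_ ?_⟩, ?_⟩
    · rw [hr₂ .count rfl]
      simp [Instr.exec, hc₁]
    · rw [hm₂ .left rfl]
      simp [Instr.exec]
    · rw [hm₂ .right rfl]
      simp [Instr.exec]
    · rw [hm₂ .val rfl]
      simp [Instr.exec, ht₁.val _ _ hd₁]
    · refine (holds_append.1 (holds_update i hk ?_ ?_)).1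
      · rw [show (δ i + 1 + 2 ^ D).toNat = (δ i + 2 ^ D).toNat + 1 by rw [h6]; omega]
        exact hk₂
      · intro q hq
        rw [ho₂ q hq]
        simp [Instr.exec, hk₁]

/-- The letter `x_i⁻¹`: here the key is used after `δ` has moved. -/
theorem decCoord_walk_subOne_halts (ht : s.IsTrie c f) (hc : s.reg .count = c)
    (h0 : s.reg .zero = 0) (h1 : s.reg .one = 1) (he : s.reg .keyEnd = (r * (D + 1) + k : ℕ))
    (hs : s.reg .start = (i * (D + 1) : ℕ))
    (hk : Holds (s.mem .key) 0 (vecCode D δ ++ bitList k i))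
    (hδ : |δ i| < 2 ^ D) (hδ' : |δ i - 1| < 2 ^ D) :
    Halts (decCoord ;; walk ;; load .v .val .node ;; pred .v ;; store .val .node .v) s
      (11 * (r * (D + 1) + k) + 3 + (4 * (D + 1) + 7)) fun s' =>
      (∃ c' : ℕ, c' ≤ c + (r * (D + 1) + k) ∧ s'.reg .count = c' ∧
        s'.IsTrie c' (Function.update f (vecCode D (Function.update δ i (δ i - 1)) ++ bitList k i)
          (f (vecCode D (Function.update δ i (δ i - 1)) ++ bitList k i) + -1))) ∧
      Holds (s'.mem .key) 0 (vecCode D (Function.update δ i (δ i - 1))) := by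
  have h6 : (2 : ℤ) ^ D = ((2 ^ D : ℕ) : ℤ) := by push_cast; rfl
  have h4 := abs_lt.1 hδ
  have h5 := abs_lt.1 hδ'
  rw [h6] at h4 h5
  have hblock := holds_vecCode.1 (holds_append.1 hk).1 i
  rw [show (δ i + 2 ^ D).toNat = (δ i - 1 + 2 ^ D).toNat + 1 by rw [h6]; omega] at hblock
  refine Halts.le (B := 4 * (D + 1) + 4 + (11 * (r * (D + 1) + k) + 3 + 3)) ?_ (by omega)
  refine (decCoord_halts (D + 1) (δ i - 1 + 2 ^ D).toNat (i * (D + 1)) hs h0 h1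
    (by rw [pow_succ, h6]; omega) hblock).seq_of fun s₁ h₁ hr₁ hm₁ => ?_
  have hk₁ := holds_update i hk h₁.1 h₁.2
  have ht₁ : s₁.IsTrie c f := ht.congr (hm₁ .left rfl) (hm₁ .right rfl) (hm₁ .val rfl)
  rw [← hr₁ .count rfl] at hc
  rw [← hr₁ .zero rfl] at h0
  rw [← hr₁ .keyEnd rfl] at he
  have hlen : (vecCode D (Function.update δ i (δ i - 1)) ++ bitList k i).length =
    r * (D + 1) + k := by simp
  have hw := walk_halts _ ht₁ hc h0 (by rw [hlen]; exact he) hk₁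
  rw [hlen] at hw
  refine hw.seq_of fun s₂ h₂ hr₂ hm₂ => ?_
  obtain ⟨c', hc', hc₂, ht₂, hd₂⟩ := h₂
  refine .instr_seq (.instr_seq (.instr ⟨⟨c', hc', ?_, (ht₂.setVal (f _ + -1) hd₂).congr ?_ ?_ ?_⟩,
    ?_⟩))
  · simp [Instr.exec, hc₂]
  · simp [Instr.exec]
  · simp [Instr.exec]
  · simp [Instr.exec, ht₂.val _ _ hd₂, sub_eq_add_neg]
  · simpa [Instr.exec, hm₂ .key rfl] using (holds_append.1 hk₁).1

end Prog

/-! ### The main loop and the running time -/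

namespace Prog

/-- The number of steps for one letter, with codes of `D + 1` and `k` bits. -/
def letterCost (r D k : ℕ) : ℕ :=
  1 + 1 + (8 * r + 8 * k + 3) + (r * (3 * D + 5) + 3) +
    (11 * (r * (D + 1) + k) + 3 + (4 * (D + 1) + 7) + 1) + 1

/-- The state of the machine after it has read the first `t` letters. -/
structure LoopInv {r : ℕ} (w : List (Fin r × Bool)) (t : ℕ) (s : MState) : Prop where
  len : s.reg .len = w.length
  zero : s.reg .zero = 0
  one : s.reg .one = 1
  digits : s.reg .digits = Nat.clog 2 (w.length + 1)
  codeStart : s.reg .codeStart = (r * (Nat.clog 2 (w.length + 1) + 1) : ℕ)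
  keyEnd : s.reg .keyEnd = (r * (Nat.clog 2 (w.length + 1) + 1) + Nat.clog 2 r : ℕ)
  pos : s.reg .t = t
  idx : s.mem .idx = (inputState r w).mem .idx
  eps : s.mem .eps = (inputState r w).mem .eps
  key : Holds (s.mem .key) 0
    (vecCode (Nat.clog 2 (w.length + 1)) (expVec (FreeGroup.mk (w.take t))))
  trie : ∃ (c : ℕ) (f : List Bool → ℤ),
    c ≤ t * (r * (Nat.clog 2 (w.length + 1) + 1) + Nat.clog 2 r) ∧
    s.reg .count = c ∧ s.IsTrie c f ∧ IsFoxMap w.length (FreeGroup.mk (w.take t)) f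

variable {r : ℕ} {w : List (Fin r × Bool)} {s : MState}

theorem letter_halts {t : ℕ} (ht : t < w.length) (h : LoopInv w t s) :
    Halts (load .i .idx .t ;; load .e .eps .t ;; writeIndex ;; locateBlock ;;
      .ifEq .e .one
       (walk ;; load .v .val .node ;; succ .v ;; store .val .node .v ;; incCoord)
       (decCoord ;; walk ;; load .v .val .node ;; pred .v ;; store .val .node .v) ;;
      succ .t) s (letterCost r (Nat.clog 2 (w.length + 1)) (Nat.clog 2 r)) (LoopInv w (t + 1)) := by
  obtain ⟨hlen, h0, h1, hD, hcs, hke, hpos, hidx, heps, hkey, c, f, hc, hcount, htrie, hfox⟩ := h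
  obtain ⟨i, b, hib⟩ : ∃ i b, w[t] = (i, b) := ⟨_, _, rfl⟩
  have htake : w.take (t + 1) = w.take t ++ [(i, b)] := by
    rw [← hib, List.take_concat_get' w t ht]
  have hget : w[t]? = some (i, b) := by rw [List.getElem?_eq_getElem ht, hib]
  have hidx' : s.mem .idx t = (i : ℕ) := by
    rw [hidx]
    simp [inputState, hget]
  have heps' : s.mem .eps t = if b then 1 else -1 := by
    rw [heps]
    simp [inputState, hget]
  -- Every prefix is bounded by the full length, so the coordinate fits its block both before and
  -- after the letter.
  have hexp : ∀ (k : ℕ) (j : Fin r), |expVec (FreeGroup.mk (w.take k)) j| ≤ w.length :=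
    fun k j => (abs_expVec_mk_le _ j).trans (by exact_mod_cast List.length_take_le' k w)
  have hmk : FreeGroup.mk (w.take (t + 1)) = FreeGroup.mk (w.take t) *
      if b then FreeGroup.of i else (FreeGroup.of i)⁻¹ := by
    rw [htake, mk_append_singleton]
  have hexp1 := hexp t
  have hexp2 := hexp (t + 1)
  rw [hmk] at hexp2
  set u := FreeGroup.mk (w.take t)
  have hnD : (w.length : ℤ) < 2 ^ Nat.clog 2 (w.length + 1) := by
    exact_mod_cast lt_two_pow_clog w.length
  set D := Nat.clog 2 (w.length + 1) with hDdef
  set k := Nat.clog 2 r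
  have hi := i.2
  have hri : (i : ℕ) * (3 * D + 5) ≤ r * (3 * D + 5) := Nat.mul_le_mul_right _ hi.le
  refine Halts.le (B := 8 * i + 8 * k + 3 + (i * (3 * D + 5) + 3 +
    (11 * (r * (D + 1) + k) + 3 + (4 * (D + 1) + 7) + 1 + 1)) + 1 + 1) ?_
    (by unfold letterCost; omega)
  refine .instr_seq (.instr_seq ?_)
  refine (writeIndex_halts (vecCode D (expVec u)) i k ?_ ?_ ?_ ?_ ?_ ?_).seq_of
    fun s₁ hk₁ hr₁ hm₁ => ?_
  · simp [Instr.exec, hpos, hidx']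
  · simp [Instr.exec, hcs]
  · simp [Instr.exec, hke]
  · simpa [Instr.exec]
  · simpa [Instr.exec]
  · simpa [Instr.exec]
  refine (locateBlock_halts i D ?_ ?_).seq_of fun s₂ hs₂ hr₂ hm₂ => ?_
  · rw [hr₁ .i rfl]
    simp [Instr.exec, hpos, hidx']
  · rw [hr₁ .digits rfl]
    simp [Instr.exec, hD]
  have hreg : ∀ z, writeIndex.writesReg z = false → locateBlock.writesReg z = false →
      z ≠ .i → z ≠ .e → s₂.reg z = s.reg z := by
    intro z hz1 hz2 hz3 hz4
    rw [hr₂ z hz2, hr₁ z hz1]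
    simp [Instr.exec, hz3, hz4]
  have hmem : ∀ A, writeIndex.writesMem A = false → locateBlock.writesMem A = false →
      s₂.mem A = s.mem A := by
    intro A hA1 hA2
    rw [hm₂ A hA2, hm₁ A hA1]
    simp [Instr.exec]
  have he₂ : s₂.reg .e = if b then 1 else -1 := by
    rw [hr₂ .e rfl, hr₁ .e rfl]
    simp [Instr.exec, hpos, heps']
  rw [← hreg .len rfl rfl (by simp) (by simp)] at hlen
  rw [← hreg .zero rfl rfl (by simp) (by simp)] at h0
  rw [← hreg .one rfl rfl (by simp) (by simp)] at h1
  rw [← hreg .digits rfl rfl (by simp) (by simp)] at hD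
  rw [← hreg .codeStart rfl rfl (by simp) (by simp)] at hcs
  rw [← hreg .keyEnd rfl rfl (by simp) (by simp)] at hke
  rw [← hreg .t rfl rfl (by simp) (by simp)] at hpos
  rw [← hreg .count rfl rfl (by simp) (by simp)] at hcount
  rw [← hmem .idx rfl rfl] at hidx
  rw [← hmem .eps rfl rfl] at heps
  rw [← hm₂ .key rfl] at hk₁
  have htrie₂ : s₂.IsTrie c f := htrie.congr (hmem .left rfl rfl) (hmem .right rfl rfl)
    (hmem .val rfl rfl)
  -- Both signs share this bound and postcondition; the rest of the invariant is preserved by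
  -- framing.
  suffices hsuff : Halts (.ifEq .e .one
      (walk ;; load .v .val .node ;; succ .v ;; store .val .node .v ;; incCoord)
      (decCoord ;; walk ;; load .v .val .node ;; pred .v ;; store .val .node .v)) s₂
      (11 * (r * (D + 1) + k) + 3 + (4 * (D + 1) + 7) + 1) fun s' =>
      (∃ (c' : ℕ) (f' : List Bool → ℤ), c' ≤ c + (r * (D + 1) + k) ∧ s'.reg .count = c' ∧
        s'.IsTrie c' f' ∧ IsFoxMap w.length (FreeGroup.mk (w.take (t + 1))) f') ∧
      Holds (s'.mem .key) 0 (vecCode D (expVec (FreeGroup.mk (w.take (t + 1))))) by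
    refine hsuff.seq_of fun s₃ h₃ hr₃ hm₃ => .instr ?_
    obtain ⟨⟨c', f', hc', hcount', htrie', hfox'⟩, hkey'⟩ := h₃
    refine ⟨?_, ?_, ?_, ?_, ?_, ?_, ?_, ?_, ?_, ?_, c', f', ?_, ?_, htrie'.congr ?_ ?_ ?_, hfox'⟩
    · simp [Instr.exec, hr₃ .len rfl, hlen]
    · simp [Instr.exec, hr₃ .zero rfl, h0]
    · simp [Instr.exec, hr₃ .one rfl, h1]
    · simp [Instr.exec, hr₃ .digits rfl, hD, hDdef]
    · simp [Instr.exec, hr₃ .codeStart rfl, hcs, hDdef]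
    · simp [Instr.exec, hr₃ .keyEnd rfl, hke, hDdef, k]
    · simp [Instr.exec, hr₃ .t rfl, hpos]
    · simp [Instr.exec, hm₃ .idx rfl, hidx]
    · simp [Instr.exec, hm₃ .eps rfl, heps]
    · simpa [Instr.exec] using hkey'
    · rw [Nat.succ_mul]
      change c' ≤ t * (r * (D + 1) + k) + (r * (D + 1) + k)
      omega
    · simp [Instr.exec, hcount']
    iterate 3 simp [Instr.exec]
  refine .ifEq ?_
  cases b
  · rw [if_neg (by simp [he₂, h1])]
    simp only [Bool.false_eq_true, if_false] at hmk hexp2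
    have hv : expVec (u * (FreeGroup.of i)⁻¹) =
        Function.update (expVec u) i (expVec u i - 1) := by
      rw [expVec_mul, expVec_inv, expVec_of, ← Pi.single_neg, add_single_eq_update, sub_eq_add_neg]
    rw [hv] at hexp2
    have hi2 := hexp2 i
    rw [Function.update_self] at hi2
    refine (decCoord_walk_subOne_halts htrie₂ hcount h0 h1 hke hs₂ hk₁
      ((hexp1 i).trans_lt hnD) (hi2.trans_lt hnD)).mono le_rfl ?_
    rintro s₃ ⟨⟨c', hc', hcount', htrie'⟩, hkey'⟩
    rw [hmk, hv]
    refine ⟨⟨c', _, hc', hcount', htrie', hfox.update hexp2 fun δ j => ?_⟩, hkey'⟩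
    rw [foxCoeff_mul_of_inv, hv]
    split_ifs <;> ring
  · rw [if_pos (by simp [he₂, h1])]
    simp only [if_true] at hmk hexp2
    have hv : expVec (u * FreeGroup.of i) = Function.update (expVec u) i (expVec u i + 1) := by
      rw [expVec_mul, expVec_of, add_single_eq_update]
    rw [hv] at hexp2
    have hi2 := hexp2 i
    rw [Function.update_self] at hi2
    refine (walk_addOne_incCoord_halts htrie₂ hcount h0 h1 hke hs₂ hk₁
      ((hexp1 i).trans_lt hnD) (hi2.trans_lt hnD)).mono le_rfl ?_
    rintro s₃ ⟨⟨c', hc', hcount', htrie'⟩, hkey'⟩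
    rw [hmk, hv]
    exact ⟨⟨c', _, hc', hcount', htrie', hfox.update hexp1 fun δ j => foxCoeff_mul_of _ _ _ _⟩,
      hkey'⟩

theorem foxProgram_halts (r : ℕ) (w : List (Fin r × Bool)) :
    Halts foxProgram (inputState r w)
      (15 * w.length + 15 * r + r * (4 * Nat.clog 2 (w.length + 1) + 6) + 3 * Nat.clog 2 r + 20 +
        (w.length * (letterCost r (Nat.clog 2 (w.length + 1)) (Nat.clog 2 r) + 1) + 1 + 1))
      (LoopInv w w.length) := by
  refine (setup_halts r w.length rfl rfl).seq_of fun s h hr hm => .instr_seq ?_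
  obtain ⟨h0, h1, hD, hcs, hke, hcount, hkey⟩ := h
  refine .whileNe_count w.length _ (LoopInv w) ?_ ?_ fun t s ht h => letter_halts ht h
  · refine ⟨?_, ?_, ?_, ?_, ?_, ?_, ?_, ?_, ?_, ?_, 0, 0, ?_, ?_, .empty ?_, ?_⟩
    · simp [Instr.exec, hr .len rfl, inputState]
    · simp [Instr.exec, h0]
    · simp [Instr.exec, h1]
    · simp [Instr.exec, hD]
    · simp [Instr.exec, hcs]
    · simp [Instr.exec, hke]
    · simp [Instr.exec]
    · simp [Instr.exec, hm .idx rfl]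
    · simp [Instr.exec, hm .eps rfl]
    · rw [List.take_zero, ← FreeGroup.one_eq_mk, expVec_one, vecCode_zero]
      simpa [Instr.exec] using hkey
    · simp
    · simp [Instr.exec, hcount]
    · intro A x hA1 hA2 hA3
      cases A <;> simp at hA1 hA2 hA3 <;> simp [Instr.exec, hm .left rfl, hm .right rfl,
        hm .val rfl, inputState]
    · rw [List.take_zero, ← FreeGroup.one_eq_mk]
      exact .one
  · rintro t s - h
    rw [h.pos, h.len]
    omega

/-- `⌈log₂(n + 1)⌉ ≤ log₂ n + 1`, and `1 ≤ log₂ n` as soon as `n ≥ 2`. -/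
theorem clog_le_two_mul_logb {n : ℕ} (hn : 2 ≤ n) :
    (Nat.clog 2 (n + 1) : ℝ) ≤ 2 * Real.logb 2 n := by
  have h1 : 2 ^ (Nat.clog 2 (n + 1) - 1) ≤ n :=
    Nat.lt_succ_iff.1 (Nat.pow_pred_clog_lt_self one_lt_two (by omega))
  have hn0 : (0 : ℝ) < n := by positivity
  have h2 : ((Nat.clog 2 (n + 1) - 1 : ℕ) : ℝ) ≤ Real.logb 2 n := by
    rw [Real.le_logb_iff_rpow_le one_lt_two hn0, Real.rpow_natCast]
    exact_mod_cast h1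
  have h3 : (1 : ℝ) ≤ Real.logb 2 n := by
    rw [Real.le_logb_iff_rpow_le one_lt_two hn0, Real.rpow_one]
    exact_mod_cast hn
  have h4 : (Nat.clog 2 (n + 1) : ℝ) ≤ ((Nat.clog 2 (n + 1) - 1 : ℕ) : ℝ) + 1 := by
    norm_cast
    omega
  linarith

/-- The sum of setup, letters and scan. Substituting `r = 1 + r'` and likewise for `n` and `D`
absorbs all lower-order terms into the product; `n * k ≤ n * r` handles the index bits. -/
theorem cost_le {r n D k : ℕ} (hr : 1 ≤ r) (hn : 1 ≤ n) (hD : 1 ≤ D) (hk : k ≤ r) :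
    15 * n + 15 * r + r * (4 * D + 6) + 3 * k + 20 + (n * (letterCost r D k + 1) + 1 + 1) +
      (5 * (n * (r * (D + 1) + k)) + 3) ≤ 300 * (r * n * D) := by
  obtain ⟨r, rfl⟩ := Nat.exists_eq_add_of_le hr
  obtain ⟨n, rfl⟩ := Nat.exists_eq_add_of_le hn
  obtain ⟨D, rfl⟩ := Nat.exists_eq_add_of_le hD
  have h := Nat.mul_le_mul_left n hk
  have h1 : 0 ≤ r * n * D := Nat.zero_le _
  have h2 : 0 ≤ r * n := Nat.zero_le _
  have h3 : 0 ≤ r * D := Nat.zero_le _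
  have h4 : 0 ≤ n * D := Nat.zero_le _
  unfold letterCost
  nlinarith

end Prog

/-! ### Assembling correctness and the time bound -/

theorem mainTheorem4 :
    ∃ C : ℝ, ∀ (r : ℕ) (w : List (Fin r × Bool)),
      ∃ (s₁ s₂ : MState) (T₁ T₂ : ℕ),
        -- The algorithm first builds the trie of the Fox derivatives, then it checks the values.
        Prog.Exec Prog.foxProgram (inputState r w) s₁ T₁ ∧
        s₁.RepresentsFox w.length (FreeGroup.mk w) ∧
        Prog.Exec Prog.checkProgram s₁ s₂ T₂ ∧
        Prog.Exec Prog.wordProblemProgram (inputState r w) s₂ (T₁ + T₂) ∧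
        -- It decides the word problem of the free metabelian group.
        (s₂.reg .answer = 1 ↔ ((FreeGroup.mk w : FreeGroup (Fin r)) : FreeMetabelian r) = 1) ∧
        (s₂.reg .answer = 0 ↔ ((FreeGroup.mk w : FreeGroup (Fin r)) : FreeMetabelian r) ≠ 1) ∧
        (((FreeGroup.mk w : FreeGroup (Fin r)) : FreeMetabelian r) = 1 ↔
          ∀ i : Fin r, foxDerivAb i (FreeGroup.mk w) = 0) ∧
        -- It takes `O(r |w| log₂ |w|)` elementary steps.
        (2 ≤ w.length →
          ((T₁ + T₂ : ℕ) : ℝ) ≤ C * (r * w.length * Real.logb 2 w.length)) := by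
  -- `600 = 300 * 2`: the constant of `cost_le` times the factor from replacing `⌈log₂(n + 1)⌉` by
  -- `log₂ n`.
  refine ⟨600, fun r w => ?_⟩
  obtain ⟨s₁, T₁, hexec₁, hT₁, hinv⟩ := Prog.foxProgram_halts r w
  obtain ⟨c, f, hc, hcount, htrie, hfox⟩ := hinv.trie
  rw [List.take_length] at hfox
  obtain ⟨s₂, T₂, hexec₂, hT₂, hans⟩ :=
    Prog.checkProgram_halts htrie hcount hinv.zero hinv.one hfox.apply_nil
  have hone : ((FreeGroup.mk w : FreeGroup (Fin r)) : FreeMetabelian r) = 1 ↔ f = 0 := by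
    rw [freeMetabelian_eq_one_iff, hfox.eq_zero_iff]
  refine ⟨s₁, s₂, T₁, T₂, hexec₁, ⟨hfox.bound, fun bs v hv => ?_⟩, hexec₂, .seq hexec₁ hexec₂,
    ?_, ?_, freeMetabelian_eq_one_iff _, fun hn => ?_⟩
  · rw [htrie.lookup_eq_some_iff hv, hfox.apply_eq_iff hv]
  · rw [hone]
    rcases hans with ⟨h1, h2⟩ | ⟨h1, h2⟩ <;> simp [h1, h2]
  · rw [ne_eq, hone]
    rcases hans with ⟨h1, h2⟩ | ⟨h1, h2⟩ <;> simp [h1, h2]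
  -- A nonempty word contains a letter, so the rank is positive.
  · have hr : 1 ≤ r := by
      obtain ⟨a, w', rfl⟩ := List.exists_cons_of_length_pos (by omega : 0 < w.length)
      exact a.1.pos
    have hcost := Prog.cost_le (n := w.length) (D := Nat.clog 2 (w.length + 1))
      (k := Nat.clog 2 r) hr (by omega) (Nat.clog_pos one_lt_two (by omega))
      (Nat.clog_le_of_le_pow Nat.lt_two_pow_self.le)
    have hT : T₁ + T₂ ≤ 300 * (r * w.length * Nat.clog 2 (w.length + 1)) := by omega
    have hT' : ((T₁ + T₂ : ℕ) : ℝ) ≤ 300 * (r * w.length * Nat.clog 2 (w.length + 1)) := by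
      exact_mod_cast hT
    have hlog := mul_le_mul_of_nonneg_left (Prog.clog_le_two_mul_logb hn)
      (by positivity : (0 : ℝ) ≤ r * w.length)
    linarith
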